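/- A non-ambiguous tree is a filling of a rectangular grid (each cell dotted or not) such that every row and every column contains a dot, and every dot other than one in the top-left cell has either a dot above it in its column or a dot to its left in its row, but not both. It is complete (a CNAT) if every dot either has both a dot below it in its column and a dot to its right in its row, or neither; in the latter case it is called a leaf dot. With columns numbered from left to right and rows from top to bottom, a CNAT on an $n\times n$ grid is associated with the permutation $\pi\in S_n$ if its leaf dots are exactly the cells in column $i$ and row $\pi_i$, $1\le i\le n$. Let $B(n,k)$ be the set of permutations $\pi\in S_n$ that are associated with exactly $k$ CNATs. For $\pi \in S_n$, let $\mathrm{Insert}_p(\pi)\in S_{n+1}$ be obtained by inserting the letter $p$ at position $p$ and increasing all letters of $\pi$ that are at least $p$ by $1$. An occurrence of a pattern in a permutation is a choice of positions $i_1<i_2<\cdots$ at which the letters have the same relative order as the pattern. **Theorem.** Let $n\ge 3$. Every $\pi\in B(n,2)$ has a unique occurrence $\pi_i,\pi_j,\pi_k$ ($i<j<k$) of the pattern $321$, and $\pi_j=j$. Put $\tilde\pi:=\mathrm{Insert}_{j+1}(\pi)$; then $\tilde\pi$ has a unique occurrence of the pattern $4231$, at the positions $i,\,j,\,j+1,\,k+1$.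 Let $\pi'\in S_{n+1}$ be the permutation obtained from $\tilde\pi$ by rearranging these four letters into the pattern $3412$, that is, $$\pi'_i=\tilde\pi_{j+1}=j+1,\qquad \pi'_j=\tilde\pi_i=\pi_i+1,\qquad \pi'_{j+1}=\tilde\pi_{k+1}=\pi_k,\qquad \pi'_{k+1}=\tilde\pi_j=j,$$ and $\pi'_\ell=\tilde\pi_\ell$ for all other $\ell$. Then the map $\pi\mapsto\pi'$ is a bijection from $B(n,2)$ to $B(n+1,3)$. -/

import Mathlib

namespace NonAmbiguousTrees

/-! Grids have columns numbered from left to right and rows numbered from top to bottom, both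
starting at 0. A cell is a pair (column, row), so that the graphical representation of a
permutation `π` consists of the cells `(i, π i)`. A filling of a grid is its set of dotted cells. -/

/-- The dot set `T` has a dot strictly above the cell `d` in its column. -/
def HasDotAbove {m n : ℕ} (T : Finset (Fin n × Fin m)) (d : Fin n × Fin m) : Prop :=
  ∃ r : Fin m, r < d.2 ∧ (d.1, r) ∈ T

/-- The dot set `T` has a dot strictly to the left of the cell `d` in its row. -/
def HasDotLeft {m n : ℕ} (T : Finset (Fin n × Fin m)) (d : Fin n × Fin m) : Prop :=
  ∃ c : Fin n, c < d.1 ∧ (c, d.2) ∈ T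

/-- The dot set `T` has a dot strictly below the cell `d` in its column. -/
def HasDotBelow {m n : ℕ} (T : Finset (Fin n × Fin m)) (d : Fin n × Fin m) : Prop :=
  ∃ r : Fin m, d.2 < r ∧ (d.1, r) ∈ T

/-- The dot set `T` has a dot strictly to the right of the cell `d` in its row. -/
def HasDotRight {m n : ℕ} (T : Finset (Fin n × Fin m)) (d : Fin n × Fin m) : Prop :=
  ∃ c : Fin n, d.1 < c ∧ (c, d.2) ∈ T

/-- A non-ambiguous tree with `m` rows and `n` columns. -/
structure IsNAT {m n : ℕ} (T : Finset (Fin n × Fin m)) : Prop where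
  /-- every column contains a dot -/
  column_nonempty : ∀ c : Fin n, ∃ r : Fin m, (c, r) ∈ T
  /-- every row contains a dot -/
  row_nonempty : ∀ r : Fin m, ∃ c : Fin n, (c, r) ∈ T
  /-- every dot outside the top-left cell has a dot above it or a dot to its left, not both -/
  unique_parent : ∀ d ∈ T, ¬ ((d.1 : ℕ) = 0 ∧ (d.2 : ℕ) = 0) →
    Xor (HasDotAbove T d) (HasDotLeft T d)

/-- A complete non-ambiguous tree: every dot has both a dot below it and a dot to its right, or
neither of these. -/
structure IsCNAT {m n : ℕ} (T : Finset (Fin n × Fin m)) : Prop extends IsNAT T where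
  complete : ∀ d ∈ T, HasDotBelow T d ↔ HasDotRight T d

/-- `d` is a leaf dot of `T`: no dot of `T` lies below it in its column or to its right in its
row. -/
def IsLeafDot {m n : ℕ} (T : Finset (Fin n × Fin m)) (d : Fin n × Fin m) : Prop :=
  d ∈ T ∧ ¬ HasDotBelow T d ∧ ¬ HasDotRight T d

/-- The complete non-ambiguous trees whose associated permutation is `π`: the leaf dots form the
graphical representation of `π`. -/
def CNATSet {n : ℕ} (π : Equiv.Perm (Fin n)) : Set (Finset (Fin n × Fin n)) :=
  {T | IsCNAT T ∧ ∀ d : Fin n × Fin n, IsLeafDot T d ↔ π d.1 = d.2}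

/-- The number of complete non-ambiguous trees with associated permutation `π`. -/
noncomputable def cnat {n : ℕ} (π : Equiv.Perm (Fin n)) : ℕ := (CNATSet π).ncard

/-- The set `B(n, k)` of the permutations of length `n` associated with exactly `k` complete
non-ambiguous trees. -/
def B (n k : ℕ) : Set (Equiv.Perm (Fin n)) := {π | cnat π = k}

/-- The letters of `π` at the positions `f 0 < f 1 < ⋯` form an occurrence of the pattern `τ`:
they appear in the same relative order as `τ`. -/
def IsOccurrence {k n : ℕ} (τ : Equiv.Perm (Fin k)) (π : Equiv.Perm (Fin n))
    (f : Fin k ↪o Fin n) : Prop :=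
  ∀ a b : Fin k, π (f a) < π (f b) ↔ τ a < τ b

/-- `f` is the unique occurrence of the pattern `τ` in `π`. -/
def IsUniqueOccurrence {k n : ℕ} (τ : Equiv.Perm (Fin k)) (π : Equiv.Perm (Fin n))
    (f : Fin k ↪o Fin n) : Prop :=
  IsOccurrence τ π f ∧ ∀ g : Fin k ↪o Fin n, IsOccurrence τ π g → g = f

/-- The pattern 321. -/
def pattern321 : Equiv.Perm (Fin 3) :=
  ⟨![2, 1, 0], ![2, 1, 0], by decide, by decide⟩

/-- The pattern 4231. -/
def pattern4231 : Equiv.Perm (Fin 4) :=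
  ⟨![3, 1, 2, 0], ![3, 1, 2, 0], by decide, by decide⟩

/-- The pattern 3412. -/
def pattern3412 : Equiv.Perm (Fin 4) :=
  ⟨![2, 3, 0, 1], ![2, 3, 0, 1], by decide, by decide⟩

/-- The insertion of the fixed point `p` into `π`: the letter `p` is put at position `p`, and the
positions and the letters of `π` that are at least `p` are increased by one. -/
def insertFixedPoint {n : ℕ} (p : Fin (n + 1)) (π : Equiv.Perm (Fin n)) :
    Equiv.Perm (Fin (n + 1)) :=
  ((finSuccEquiv' p).trans (Equiv.optionCongr π)).trans (finSuccEquiv' p).symm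

theorem insertFixedPoint_self {n : ℕ} (p : Fin (n + 1)) (π : Equiv.Perm (Fin n)) :
    insertFixedPoint p π p = p := by
  simp [insertFixedPoint]

theorem insertFixedPoint_succAbove {n : ℕ} (p : Fin (n + 1)) (π : Equiv.Perm (Fin n))
    (i : Fin n) : insertFixedPoint p π (p.succAbove i) = p.succAbove (π i) := by
  simp [insertFixedPoint]

/-- The positions `i, j, j + 1, k + 1` obtained from the positions `i < j < k`. -/
def splitMiddle {n : ℕ} (f : Fin 3 ↪o Fin n) : Fin 4 ↪o Fin (n + 1) :=
  OrderEmbedding.ofStrictMono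
    ![(f 0).castSucc, (f 1).castSucc, (f 1).succ, (f 2).succ] (by
      rw [Fin.strictMono_iff_lt_succ]
      intro a
      fin_cases a <;> simp)

/-- Rearranges the letters of `π` at the positions `f` from the relative order `τ` to the relative
order `τ'`, and leaves the other letters unchanged. -/
noncomputable def changePattern {k n : ℕ} (τ τ' : Equiv.Perm (Fin k)) (f : Fin k ↪o Fin n)
    (π : Equiv.Perm (Fin n)) : Equiv.Perm (Fin n) :=
  (Equiv.Perm.viaEmbedding (τ'.trans τ.symm) f.toEmbedding).trans π

theorem changePattern_apply {k n : ℕ} (τ τ' : Equiv.Perm (Fin k)) (f : Fin k ↪o Fin n)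
    (π : Equiv.Perm (Fin n)) (a : Fin k) :
    changePattern τ τ' f π (f a) = π (f (τ.symm (τ' a))) := by
  have h := Equiv.Perm.viaEmbedding_apply (τ'.trans τ.symm) f.toEmbedding a
  simp only [RelEmbedding.coe_toEmbedding] at h
  simp [changePattern, h]

theorem changePattern_apply_of_notMem {k n : ℕ} (τ τ' : Equiv.Perm (Fin k)) (f : Fin k ↪o Fin n)
    (π : Equiv.Perm (Fin n)) (l : Fin n) (hl : l ∉ Set.range f) :
    changePattern τ τ' f π l = π l := by
  have h := Equiv.Perm.viaEmbedding_apply_of_notMem (τ'.trans τ.symm) f.toEmbedding l hl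
  simp [changePattern, h]

open Classical in
/-- The map `π ↦ π'`. If `i < j < k` are the positions of the unique occurrence of 321 in `π`,
a fixed point is inserted into `π` at `j + 1`, and the occurrence of 4231 at the positions
`i, j, j + 1, k + 1` is then changed to an occurrence of 3412. (Where 321 does not occur exactly
once the value is irrelevant.) -/
noncomputable def insertAndSwitch {n : ℕ} (π : Equiv.Perm (Fin n)) : Equiv.Perm (Fin (n + 1)) :=
  if h : ∃ f : Fin 3 ↪o Fin n, IsUniqueOccurrence pattern321 π f then
    changePattern pattern4231 pattern3412 (splitMiddle h.choose)
      (insertFixedPoint (h.choose 1).succ π)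
  else insertFixedPoint 0 π

end NonAmbiguousTrees

/-! The inner dots of a CNAT with permutation `π` lie in cells `(x, π y)` with `x < y` and `π y < π
x`, so they are edges of the inversion graph of `π`. Under this encoding (`dotSet`), the condition
that no dot has two parents says that the edge set contains no broken circuit for the order
`cellOrder`, and the existence of parents corresponds to connectedness. So CNATs are spanning trees
without broken circuits (`cnat_eq_nbcNumber`). By Whitney's theorem (`sum_connected_eq`) their
number does not depend on the order of the edges: it is an invariant of the graph, `nbcNumber`.

Vertex deletion shows that a connected graph with more edges than vertices has `nbcNumber` at least
4 (`nbcNumber_bounds`), while fewer edges than vertices give at most 1. Hence the values 2 and 3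
force a unicyclic graph, where the value is the number of non-bridges minus one. A unicyclic
inversion graph contains a 321 (a triangle) or a 3412 (a square) by `exists_pattern`, so these
patterns characterize the values 2 and 3 (`mem_B_two_iff`, `mem_B_three_iff`). Uniqueness of the
cycle makes the pattern unique.

The middle letter of a unique 321 is a fixed point, and doubling it adds two inversions. Changing
the resulting 4231 to 3412 removes one, so vertices and edges both increase by one. Connectedness,
read off from the cuts of the permutation, is preserved in both directions, hence so is unicyclicity
(`IsPivot.isUnicyclic_splitSwitch_iff`). Conversely, around a 3412 in a unicyclic inversion graph
the other letters are confined to two regions (`IsUnicyclic.outside_pattern3412`). This forces the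
two middle positions to be adjacent and lets the construction be reversed (`exists_splitSwitch_eq`).
-/

namespace NonAmbiguousTrees

/-! ### Spanning trees without broken circuits and Whitney's theorem -/

section BrokenCircuits

open Finset SimpleGraph

variable {V α : Type*}

theorem reachable_map_of_adj {W : Type*} {G : SimpleGraph V} {H : SimpleGraph W} (f : V → W)
    (h : ∀ x y, G.Adj x y → H.Reachable (f x) (f y)) {x y : V} (hxy : G.Reachable x y) :
    H.Reachable (f x) (f y) := by
  obtain ⟨p⟩ := hxy
  induction p with
  | nil => exact Reachable.refl _
  | cons hadj _ ih => exact (h _ _ hadj).trans ih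

theorem mem_of_reachable {G : SimpleGraph V} {S : Set V}
    (h : ∀ x y, G.Adj x y → x ∈ S → y ∈ S) {x y : V} (hxy : G.Reachable x y) (hx : x ∈ S) :
    y ∈ S := by
  obtain ⟨p⟩ := hxy
  induction p with
  | nil => exact hx
  | cons hadj _ ih => exact ih (h _ _ hadj hx)

/-- The graph with a given finite set of edges (loops are ignored). -/
def edgeGraph (A : Finset (Sym2 V)) : SimpleGraph V := fromEdgeSet (A : Set (Sym2 V))

theorem edgeGraph_adj {A : Finset (Sym2 V)} {x y : V} :
    (edgeGraph A).Adj x y ↔ s(x, y) ∈ A ∧ x ≠ y := by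
  simp [edgeGraph]

theorem reachable_of_mem {A : Finset (Sym2 V)} {x y : V} (h : s(x, y) ∈ A) :
    (edgeGraph A).Reachable x y := by
  by_cases hxy : x = y
  · exact hxy ▸ Reachable.refl _
  · exact (edgeGraph_adj.2 ⟨h, hxy⟩).reachable

theorem edgeGraph_mono {A A' : Finset (Sym2 V)} (h : A ⊆ A') : edgeGraph A ≤ edgeGraph A' :=
  fromEdgeSet_mono (by exact_mod_cast h)

variable [LinearOrder α]

/-- The edge `e` is active for the edge set `A`: its ends are joined by smaller edges of `A`. -/
def IsActive (r : Sym2 V → α) (A : Finset (Sym2 V)) (e : Sym2 V) : Prop :=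
  ∃ u v, e = s(u, v) ∧ (edgeGraph (A.filter (fun f => r f < r e))).Reachable u v

theorem isActive_mk {r : Sym2 V → α} {A : Finset (Sym2 V)} {u v : V} :
    IsActive r A s(u, v) ↔
      (edgeGraph (A.filter (fun f => r f < r s(u, v)))).Reachable u v := by
  constructor
  · rintro ⟨a, b, hab, h⟩
    rcases Sym2.eq_iff.1 hab with ⟨rfl, rfl⟩ | ⟨rfl, rfl⟩
    · exact h
    · exact h.symm
  · exact fun h => ⟨u, v, rfl, h⟩

/-- `A` is a set of edges in `E` that connects all vertices and for which no edge of `E` is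
active, i.e. a spanning tree that contains no broken circuit. -/
structure IsNBC (r : Sym2 V → α) (E A : Finset (Sym2 V)) : Prop where
  subset : A ⊆ E
  connected : (edgeGraph A).Connected
  not_active : ∀ e ∈ E, ¬ IsActive r A e

open Classical in
/-- The finite set of the spanning trees in `E` without broken circuits. -/
noncomputable def nbcTrees (r : Sym2 V → α) (E : Finset (Sym2 V)) :
    Finset (Finset (Sym2 V)) :=
  E.powerset.filter (IsNBC r E)

theorem mem_nbcTrees {r : Sym2 V → α} {E A : Finset (Sym2 V)} :
    A ∈ nbcTrees r E ↔ IsNBC r E A := by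
  simp only [nbcTrees, mem_filter, mem_powerset, and_iff_right_iff_imp]
  exact fun h => h.subset

/-- An active edge is redundant for connectivity: wherever a path uses `e`, the smaller edges of `A`
joining its ends can replace it. -/
theorem reachable_of_isActive {r : Sym2 V → α} {A B A' : Finset (Sym2 V)} {e : Sym2 V}
    (he : IsActive r A e) (hB : ∀ f ∈ B, f ≠ e → f ∈ A') (hA : ∀ f ∈ A, r f < r e → f ∈ A')
    {x y : V} (h : (edgeGraph B).Reachable x y) : (edgeGraph A').Reachable x y := by
  refine reachable_map_of_adj id (fun a b hab => ?_) h
  rw [edgeGraph_adj] at hab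
  by_cases hee : s(a, b) = e
  · subst hee
    refine (isActive_mk.1 he).mono (edgeGraph_mono fun f hf => ?_)
    rw [mem_filter] at hf
    exact hA f hf.1 hf.2
  · exact reachable_of_mem (hB _ hab.1 hee)

/-- Activity only looks at strictly smaller edges, so the membership of `e` itself is irrelevant. -/
theorem isActive_congr {r : Sym2 V → α} {A A' : Finset (Sym2 V)} {e : Sym2 V}
    (h : ∀ f, f ≠ e → (f ∈ A ↔ f ∈ A')) : IsActive r A e ↔ IsActive r A' e := by
  have : A.filter (fun f => r f < r e) = A'.filter (fun f => r f < r e) := by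
    ext f
    simp only [mem_filter, and_congr_left_iff]
    exact fun hf => h f (by rintro rfl; exact lt_irrefl _ hf)
  rw [IsActive, IsActive, this]

/-- Toggling an active edge `e` creates no active edge above `e`, because `e` can be bypassed by
still smaller edges. This keeps the largest active edge in place in the involution below. -/
theorem IsActive.of_agree {r : Sym2 V → α} {A A' : Finset (Sym2 V)} {e f : Sym2 V}
    (h : ∀ g, g ≠ e → (g ∈ A ↔ g ∈ A')) (he : IsActive r A e) (hef : r e ≤ r f)
    (hf : IsActive r A' f) : IsActive r A f := by
  obtain ⟨u, v, rfl, hf⟩ := hf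
  refine ⟨u, v, rfl, reachable_of_isActive he (fun g hg hge => ?_) (fun g hg hge => ?_) hf⟩
  · rw [mem_filter] at hg ⊢
    exact ⟨(h g hge).2 hg.1, hg.2⟩
  · rw [mem_filter]
    exact ⟨hg, hge.trans_le hef⟩

theorem connected_of_agree {r : Sym2 V → α} {A A' : Finset (Sym2 V)} {e : Sym2 V}
    (h : ∀ g, g ≠ e → (g ∈ A ↔ g ∈ A')) (he : IsActive r A e)
    (hc : (edgeGraph A').Connected) : (edgeGraph A).Connected := by
  have := hc.nonempty
  refine ⟨fun x y => ?_⟩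
  exact reachable_of_isActive he (fun f hf hfe => (h f hfe).2 hf) (fun f hf _ => hf)
    (hc.preconnected x y)

theorem connected_erase [DecidableEq V] {A : Finset (Sym2 V)} (h : (edgeGraph A).Connected)
    {u v : V} (huv : (edgeGraph (A.erase s(u, v))).Reachable u v) :
    (edgeGraph (A.erase s(u, v))).Connected := by
  have := h.nonempty
  refine ⟨fun x y => reachable_map_of_adj id (fun a b hab => ?_) (h.preconnected x y)⟩
  rw [edgeGraph_adj] at hab
  by_cases he : s(a, b) = s(u, v)
  · rcases Sym2.eq_iff.1 he with ⟨rfl, rfl⟩ | ⟨rfl, rfl⟩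
    · exact huv
    · exact huv.symm
  · exact reachable_of_mem (mem_erase.2 ⟨he, hab.1⟩)

variable [Fintype V]

/-- The largest edge of a cycle in `A` would be active, so `A` is a tree. -/
theorem IsNBC.card_add_one {r : Sym2 V → α} {E A : Finset (Sym2 V)} (hr : Set.InjOn r E)
    (hA : IsNBC r E A) : #A + 1 = Fintype.card V := by
  classical
  have hacyc : (edgeGraph A).IsAcyclic := by
    intro x p hp
    have hne : p.edges.toFinset.Nonempty := by
      rw [List.toFinset_nonempty_iff]
      intro h0
      have := hp.three_le_length
      rw [← p.length_edges, h0] at this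
      simp at this
    have hsub : ∀ f ∈ p.edges, f ∈ A := fun f hf => by
      have := p.edges_subset_edgeSet hf
      simp only [edgeGraph, edgeSet_fromEdgeSet] at this
      exact this.1
    obtain ⟨e, he, hmax⟩ := exists_max_image p.edges.toFinset r hne
    rw [List.mem_toFinset] at he
    have hedge : ∀ f ∈ p.edges, f ∈ (edgeGraph p.edges.toFinset).edgeSet := fun f hf => by
      have := p.edges_subset_edgeSet hf
      simp only [edgeGraph, edgeSet_fromEdgeSet] at this ⊢
      exact ⟨mem_coe.2 (List.mem_toFinset.2 hf), this.2⟩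
    induction e using Sym2.ind with
    | _ u v =>
    have := (adj_and_reachable_delete_edges_iff_exists_cycle (v := u) (w := v)).2
      ⟨x, p.transfer _ hedge, hp.transfer _, by simpa using he⟩
    refine hA.not_active _ (hA.subset (hsub _ he)) ⟨u, v, rfl, this.2.mono ?_⟩
    intro a b hab
    rw [deleteEdges_adj, edgeGraph_adj] at hab
    obtain ⟨⟨h1, h2⟩, h3⟩ := hab
    rw [edgeGraph_adj, mem_filter]
    rw [List.mem_toFinset] at h1
    refine ⟨⟨hsub _ h1, lt_of_le_of_ne (hmax _ (by simpa using h1)) fun h => h3 ?_⟩, h2⟩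
    exact hr (hA.subset (hsub _ h1)) (hA.subset (hsub _ he)) h
  have htree : (edgeGraph A).IsTree := ⟨hA.connected, hacyc⟩
  rw [← htree.card_edgeFinset]
  congr 2
  ext e
  rw [mem_edgeFinset]
  simp only [edgeGraph, edgeSet_fromEdgeSet, Set.mem_sdiff, mem_coe]
  refine ⟨fun h => ⟨h, ?_⟩, fun h => h.1⟩
  -- A loop is active for every set, so `A` contains none and the edge set of its graph is all of
  -- `A`.
  intro hd
  induction e using Sym2.ind with
  | _ u v =>
  have huv : u = v := by simpa using hd
  subst huv
  exact hA.not_active _ (hA.subset h) ⟨u, u, rfl, Reachable.refl _⟩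

open Classical in
/-- Whitney's broken circuit theorem, for the edge sets that connect all vertices. -/
theorem sum_connected_eq (r : Sym2 V → α) (E : Finset (Sym2 V)) (hr : Set.InjOn r E) :
    ∑ A ∈ E.powerset with (edgeGraph A).Connected, (-1 : ℤ) ^ #A =
      (-1) ^ (Fintype.card V - 1) * #(nbcTrees r E) := by
  -- The sets with an active edge cancel under the sign-reversing involution that toggles the
  -- largest active edge; the remaining sets are the trees to be counted.
  rw [← sum_filter_add_sum_filter_not _ (fun A => ∃ e ∈ E, IsActive r A e)]
  have hmax : ∀ A : Finset (Sym2 V), (∃ e ∈ E, IsActive r A e) →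
      ∃ e ∈ E, IsActive r A e ∧ ∀ f ∈ E, IsActive r A f → r f ≤ r e := by
    rintro A ⟨e, he, hea⟩
    obtain ⟨m, hm, hm'⟩ := exists_max_image (E.filter (IsActive r A)) r
      ⟨e, mem_filter.2 ⟨he, hea⟩⟩
    rw [mem_filter] at hm
    exact ⟨m, hm.1, hm.2, fun f hf hfa => hm' f (mem_filter.2 ⟨hf, hfa⟩)⟩
  choose m hmE hmA hmmax using hmax
  have hagree : ∀ (A : Finset (Sym2 V)) (e g : Sym2 V), g ≠ e → (g ∈ A ↔ g ∈ symmDiff A {e}) := by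
    intro A e g hg
    simp [mem_symmDiff, hg]
  have hact : ∀ A (h : ∃ e ∈ E, IsActive r A e),
      IsActive r (symmDiff A {m A h}) (m A h) := fun A h =>
    (isActive_congr (hagree A (m A h))).1 (hmA A h)
  have hsame : ∀ A (h : ∃ e ∈ E, IsActive r A e)
      (h' : ∃ e ∈ E, IsActive r (symmDiff A {m A h}) e),
      m (symmDiff A {m A h}) h' = m A h := by
    intro A h h'
    refine hr (hmE _ _) (hmE _ _) (le_antisymm ?_ (hmmax _ h' _ (hmE A h) (hact A h)))
    by_contra! hlt
    exact hlt.not_ge (hmmax A h _ (hmE _ _)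
      ((hmA A h).of_agree (hagree A _) hlt.le (hmA _ h')))
  have hzero : ∑ A ∈ {A ∈ {A ∈ E.powerset | (edgeGraph A).Connected} |
      ∃ e ∈ E, IsActive r A e}, (-1 : ℤ) ^ #A = 0 := by
    refine sum_involution (fun A hA => symmDiff A {m A (mem_filter.1 hA).2}) ?_ ?_ ?_ ?_
    · intro A hA
      set e := m A (mem_filter.1 hA).2
      by_cases he : e ∈ A
      · have : symmDiff A {e} = A.erase e := by
          ext f
          simp only [mem_symmDiff, mem_singleton, mem_erase]
          constructor
          · rintro (⟨h1, h2⟩ | ⟨rfl, h2⟩)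
            · exact ⟨h2, h1⟩
            · exact absurd he h2
          · exact fun h => Or.inl ⟨h.2, h.1⟩
        rw [this, ← card_erase_add_one he, pow_succ]
        ring
      · have : symmDiff A {e} = insert e A := by
          ext f
          simp only [mem_symmDiff, mem_singleton, mem_insert]
          constructor
          · rintro (⟨h1, h2⟩ | ⟨rfl, h2⟩)
            · exact Or.inr h1
            · exact Or.inl rfl
          · rintro (rfl | h)
            · exact Or.inr ⟨rfl, he⟩
            · exact Or.inl ⟨h, by rintro rfl; exact he h⟩
        rw [this, card_insert_of_notMem he, pow_succ]
        ring
    · intro A hA _ h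
      rw [symmDiff_eq_left] at h
      exact singleton_ne_empty _ h
    · intro A hA
      have h := (mem_filter.1 hA).2
      rw [mem_filter, mem_filter, mem_powerset] at hA ⊢
      refine ⟨⟨fun f hf => ?_, ?_⟩, _, hmE A h, hact A h⟩
      · rw [mem_symmDiff, mem_singleton] at hf
        rcases hf with hf | hf
        · exact hA.1.1 hf.1
        · exact hf.1 ▸ hmE A h
      · exact connected_of_agree (fun g hg => (hagree A _ g hg).symm) (hact A h) hA.1.2
    · intro A hA
      have h := (mem_filter.1 hA).2
      simp only [hsame A h ⟨_, hmE A h, hact A h⟩]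
      exact symmDiff_symmDiff_cancel_right _ _
  have hset : ({A ∈ {A ∈ E.powerset | (edgeGraph A).Connected} |
      ¬ ∃ e ∈ E, IsActive r A e} : Finset _) = nbcTrees r E := by
    ext A
    rw [mem_nbcTrees, mem_filter, mem_filter, mem_powerset]
    constructor
    · rintro ⟨⟨h1, h2⟩, h3⟩
      exact ⟨h1, h2, fun e he hea => h3 ⟨e, he, hea⟩⟩
    · rintro ⟨h1, h2, h3⟩
      exact ⟨⟨h1, h2⟩, fun ⟨e, he, hea⟩ => h3 e he hea⟩
  rw [hzero, zero_add, hset, sum_congr rfl (g := fun _ => (-1 : ℤ) ^ (Fintype.card V - 1))]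
  · rw [sum_const, nsmul_eq_mul, mul_comm]
  · intro A hA
    rw [← (mem_nbcTrees.1 hA).card_add_one hr, Nat.add_sub_cancel]

/-- The signed sum in `sum_connected_eq` does not involve the order of the edges. -/
theorem card_nbcTrees_eq {β : Type*} [LinearOrder β] {r : Sym2 V → α} {s : Sym2 V → β}
    {E : Finset (Sym2 V)} (hr : Set.InjOn r E) (hs : Set.InjOn s E) :
    #(nbcTrees r E) = #(nbcTrees s E) := by
  have h := (sum_connected_eq r E hr).symm.trans (sum_connected_eq s E hs)
  have h1 : ((-1 : ℤ) ^ (Fintype.card V - 1)) ≠ 0 := by simp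
  exact_mod_cast mul_left_cancel₀ h1 h

theorem card_le_of_connected {A : Finset (Sym2 V)} (h : (edgeGraph A).Connected) :
    Fintype.card V ≤ #A + 1 := by
  have h1 := h.card_vert_le_card_edgeSet_add_one
  rw [Nat.card_eq_fintype_card] at h1
  refine h1.trans (Nat.add_le_add_right ?_ 1)
  have : (edgeGraph A).edgeSet ⊆ (A : Set (Sym2 V)) := by
    simp [edgeGraph]
  have := Nat.card_mono A.finite_toSet this
  simpa using this

/-- No edge of `C` is a bridge of a connected graph that contains `C`. -/
def IsBridgeless [DecidableEq V] (C : Finset (Sym2 V)) : Prop :=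
  ∀ A, C ⊆ A → (edgeGraph A).Connected → ∀ e ∈ C, (edgeGraph (A.erase e)).Connected

open Classical in
/-- The edges of `E` whose removal leaves all vertices connected. -/
noncomputable def nonBridges [DecidableEq V] (E : Finset (Sym2 V)) : Finset (Sym2 V) :=
  E.filter (fun e => (edgeGraph (E.erase e)).Connected)

theorem mem_nonBridges [DecidableEq V] {E : Finset (Sym2 V)} {e : Sym2 V} :
    e ∈ nonBridges E ↔ e ∈ E ∧ (edgeGraph (E.erase e)).Connected := by
  simp [nonBridges]

theorem IsBridgeless.subset_nonBridges [DecidableEq V] {C E : Finset (Sym2 V)}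
    (hC : IsBridgeless C) (hE : (edgeGraph E).Connected) (hCE : C ⊆ E) : C ⊆ nonBridges E := by
  intro e he
  rw [mem_nonBridges]
  exact ⟨hCE he, hC E hCE hE e he⟩

/-- If a non-bridge `f` lay outside `C`, then removing `f` and afterwards an edge of `C` would leave
a connected graph with too few edges. -/
theorem IsBridgeless.eq_nonBridges [DecidableEq V] {C E : Finset (Sym2 V)}
    (hC : IsBridgeless C) (hE : (edgeGraph E).Connected) (hCE : C ⊆ E) (hne : C.Nonempty)
    (hcard : #E = Fintype.card V) : C = nonBridges E := by
  refine (hC.subset_nonBridges hE hCE).antisymm fun f hf => ?_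
  by_contra hfC
  rw [mem_nonBridges] at hf
  obtain ⟨e, he⟩ := hne
  have hfe := hf.2
  have h1 := card_le_of_connected (hC (E.erase f)
    (fun g hg => mem_erase.2 ⟨by rintro rfl; exact hfC hg, hCE hg⟩) hfe e he)
  have h2 : e ∈ E.erase f := mem_erase.2 ⟨by rintro rfl; exact hfC he, hCE he⟩
  have h3 := card_erase_add_one h2
  have h4 := card_erase_add_one hf.1
  omega

open Classical in
-- The connecting subsets of `E` are `E` itself and `E` minus one non-bridge, and these two kinds
-- enter Whitney's sum with opposite signs.
theorem card_nbcTrees_add_one [DecidableEq V] {r : Sym2 V → α} {E : Finset (Sym2 V)} (hr : Set.InjOn r E)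
    (hE : (edgeGraph E).Connected) (hcard : #E = Fintype.card V) :
    #(nbcTrees r E) + 1 = #(nonBridges E) := by
  have hset : ({A ∈ E.powerset | (edgeGraph A).Connected} : Finset _) =
      insert E ((nonBridges E).image E.erase) := by
    ext A
    rw [mem_filter, mem_powerset, mem_insert, mem_image]
    constructor
    · rintro ⟨hAE, hA⟩
      by_cases h : A = E
      · exact Or.inl h
      · right
        obtain ⟨e, he, heA⟩ := exists_of_ssubset (hAE.ssubset_of_ne h)
        have hsub : A ⊆ E.erase e := fun f hf => mem_erase.2 ⟨by rintro rfl; exact heA hf, hAE hf⟩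
        have h1 := card_erase_add_one he
        have h2 := card_le_of_connected hA
        have h3 : A = E.erase e := eq_of_subset_of_card_le hsub (by omega)
        refine ⟨e, ?_, h3.symm⟩
        rw [mem_nonBridges]
        exact ⟨he, h3 ▸ hA⟩
    · rintro (rfl | ⟨e, he, rfl⟩)
      · exact ⟨Subset.refl _, hE⟩
      · rw [mem_nonBridges] at he
        exact ⟨erase_subset _ _, he.2⟩
  have h : ∑ A ∈ E.powerset with (edgeGraph A).Connected, (-1 : ℤ) ^ #A =
      (-1) ^ (Fintype.card V - 1) * #(nbcTrees r E) := by
    convert sum_connected_eq r E hr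
  have hpos : 0 < Fintype.card V := Fintype.card_pos_iff.2 hE.nonempty
  rw [hset, sum_insert, sum_image] at h
  · have : ∀ e ∈ nonBridges E, (-1 : ℤ) ^ #(E.erase e) = (-1) ^ (Fintype.card V - 1) := by
      intro e he
      rw [mem_nonBridges] at he
      have := card_erase_add_one he.1
      congr 1
      omega
    rw [sum_congr rfl this, sum_const, nsmul_eq_mul, hcard] at h
    obtain ⟨k, hk⟩ := Nat.exists_eq_succ_of_ne_zero hpos.ne'
    rw [hk, Nat.succ_sub_one, pow_succ] at h
    have h1 : ((-1 : ℤ) ^ k) ≠ 0 := by simp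
    have h2 : (-1 : ℤ) ^ k * (-1 + #(nonBridges E)) = (-1) ^ k * #(nbcTrees r E) := by
      rw [← h]; ring
    have := mul_left_cancel₀ h1 h2
    omega
  · intro e he f hf hef
    have he' : e ∈ E := (mem_nonBridges.1 he).1
    by_contra hne
    have : e ∈ E.erase f := mem_erase.2 ⟨hne, he'⟩
    rw [← hef] at this
    exact notMem_erase e E this
  · intro h0
    obtain ⟨e, he, h1⟩ := mem_image.1 h0
    have : e ∈ E := (mem_nonBridges.1 he).1
    rw [← h1] at this
    exact notMem_erase e E this

end BrokenCircuits

/-! ### Lower bounds by vertex deletion -/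

section VertexDeletion

open Finset SimpleGraph

/-- The edge set of a finite graph as a finite set. -/
noncomputable def edges {V : Type*} [Finite V] (G : SimpleGraph V) : Finset (Sym2 V) :=
  (Set.toFinite G.edgeSet).toFinset

@[simp]
theorem mem_edges {V : Type*} [Finite V] {G : SimpleGraph V} {e : Sym2 V} :
    e ∈ edges G ↔ e ∈ G.edgeSet := by
  simp [edges]

theorem edges_eq_edgeFinset {V : Type*} [Finite V] (G : SimpleGraph V) [Fintype G.edgeSet] :
    edges G = G.edgeFinset := by
  ext e
  simp

theorem edgeGraph_edges {V : Type*} [Finite V] (G : SimpleGraph V) :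
    edgeGraph (edges G) = G := by
  ext x y
  rw [edgeGraph_adj, mem_edges, mem_edgeSet]
  exact ⟨fun h => h.1, fun h => ⟨h, h.ne⟩⟩

open Classical in
/-- The number of the spanning trees of `G` without broken circuits, with respect to an arbitrary
order of the edges. -/
noncomputable def nbcNumber {V : Type*} [Fintype V] (G : SimpleGraph V) : ℕ :=
  #(nbcTrees (Fintype.equivFin (Sym2 V)) (edges G))

theorem nbcNumber_eq {V α : Type*} [Fintype V] [LinearOrder α] {G : SimpleGraph V}
    {r : Sym2 V → α} (hr : Set.InjOn r (edges G)) : nbcNumber G = #(nbcTrees r (edges G)) :=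
  card_nbcTrees_eq (Equiv.injective _).injOn hr

theorem connected_of_nbcNumber_pos {V : Type*} [Fintype V] {G : SimpleGraph V}
    (h : 0 < nbcNumber G) : G.Connected := by
  obtain ⟨A, hA⟩ := card_pos.1 h
  rw [mem_nbcTrees] at hA
  rw [← edgeGraph_edges G]
  exact hA.connected.mono (edgeGraph_mono hA.subset)

theorem nbcNumber_le_one {V : Type*} [Fintype V] {G : SimpleGraph V}
    (h : #(edges G) < Fintype.card V) : nbcNumber G ≤ 1 := by
  refine card_le_one.2 fun A hA B hB => ?_
  rw [mem_nbcTrees] at hA hB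
  have h1 := card_le_of_connected hA.connected
  have h2 := card_le_of_connected hB.connected
  rw [eq_of_subset_of_card_le hA.subset (by omega), eq_of_subset_of_card_le hB.subset (by omega)]

theorem card_edges_induce_compl_singleton {V : Type*} [Fintype V] (G : SimpleGraph V) (v : V) :
    #(edges (G.induce {v}ᶜ)) + (G.neighborSet v).ncard = #(edges G) := by
  classical
  have h1 := G.card_edgeFinset_induce_compl_singleton v
  rw [G.card_edgeFinset_deleteIncidenceSet v] at h1
  have h2 : (G.neighborSet v).ncard = G.degree v := by
    rw [Set.ncard_eq_toFinset_card', ← card_neighborFinset_eq_degree]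
    rfl
  have h3 := G.degree_le_card_edgeFinset (v := v)
  rw [edges_eq_edgeFinset, edges_eq_edgeFinset, h1, h2]
  omega

/-- Deletion of a vertex `v` whose removal leaves the graph connected. -/
theorem degree_mul_nbcNumber_le {V : Type*} [Fintype V] (G : SimpleGraph V) (v : V)
    [Fintype ({v}ᶜ : Set V)] :
    (G.neighborSet v).ncard * nbcNumber (G.induce {v}ᶜ) ≤ nbcNumber G := by
  classical
  let rank : Sym2 V → ℕ := fun e => Fintype.equivFin (Sym2 V) e
  have hrank : Function.Injective rank := fun a b h =>
    (Fintype.equivFin (Sym2 V)).injective (Fin.val_injective h)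
  -- The edges at `v` come first. For this order, adding any one edge at `v` to a tree of `G - v`
  -- without broken circuits creates no broken circuit in `G`.
  let r : Sym2 V → ℕ ×ₗ ℕ := fun e => toLex (if v ∈ e then 0 else 1, rank e)
  have hr : Function.Injective r := fun a b h => hrank (congrArg (fun x => (ofLex x).2) h)
  let ι : Sym2 ({v}ᶜ : Set V) ↪ Sym2 V :=
    ⟨Sym2.map Subtype.val, Sym2.map.injective Subtype.val_injective⟩
  have hι : ∀ e, v ∉ ι e := by
    intro e he
    obtain ⟨a, _, ha⟩ := Sym2.mem_map.1 he
    exact a.2 ha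
  rw [nbcNumber_eq (hr.injOn : Set.InjOn r (edges G)),
    nbcNumber_eq ((hr.comp ι.injective).injOn : Set.InjOn (r ∘ ι) (edges (G.induce {v}ᶜ))),
    Set.ncard_eq_toFinset_card', ← card_product]
  refine card_le_card_of_injOn (fun p => insert s(v, p.1) (p.2.map ι)) ?_ ?_
  · rintro ⟨w, A⟩ hp
    rw [coe_product, Set.mem_prod] at hp
    obtain ⟨hw, hA⟩ := hp
    simp only [Set.coe_toFinset, mem_neighborSet] at hw
    simp only [mem_coe, mem_nbcTrees] at hA ⊢
    have hwv : w ∈ ({v}ᶜ : Set V) := hw.ne'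
    have hmem : ∀ x y : ({v}ᶜ : Set V), s(x, y) ∈ A →
        s((x : V), (y : V)) ∈ insert s(v, w) (A.map ι) := fun x y h =>
      mem_insert_of_mem (mem_map.2 ⟨s(x, y), h, rfl⟩)
    refine ⟨?_, ?_, ?_⟩
    · intro e he
      rw [mem_insert, mem_map] at he
      rcases he with rfl | ⟨e, he, rfl⟩
      · simpa using hw
      · have := hA.subset he
        induction e using Sym2.ind with
        | _ x y => simpa [ι] using this
    · rw [connected_iff_exists_forall_reachable]
      refine ⟨w, fun x => ?_⟩
      by_cases hx : x = v
      · subst hx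
        exact (reachable_of_mem (mem_insert_self _ _)).symm
      · refine reachable_map_of_adj (Subtype.val : ({v}ᶜ : Set V) → V) (fun a b hab => ?_)
          (hA.connected.preconnected ⟨w, hwv⟩ ⟨x, hx⟩)
        exact reachable_of_mem (hmem a b (edgeGraph_adj.1 hab).1)
    · intro f hf hact
      induction f using Sym2.ind with
      | _ x y =>
      rw [isActive_mk] at hact
      -- The only edge of the new tree that can precede an edge `s(v, z)` is `s(v, w)`, and then `w
      -- ≠ z`; so `z` stays isolated.
      have hlow : ∀ z, s(v, z) ∈ (edges G) →
          (∀ e ∈ (insert s(v, w) (A.map ι)).filter (fun f => r f < r s(v, z)),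
            e = s(v, w) ∧ w ≠ z) := by
        intro z hz e he
        rw [mem_filter, mem_insert, mem_map] at he
        obtain ⟨rfl | ⟨e, _, rfl⟩, hlt⟩ := he
        · exact ⟨rfl, by rintro rfl; exact lt_irrefl _ hlt⟩
        · exfalso
          rw [Prod.Lex.lt_iff] at hlt
          simp [r, hι] at hlt
      have hnot : ∀ z, s(v, z) ∈ edges G → ¬ (edgeGraph ((insert s(v, w) (A.map ι)).filter
          (fun f => r f < r s(v, z)))).Reachable v z := by
        intro z hz hreach
        have hzv : z ≠ v := by
          rintro rfl
          simp at hz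
        have : z ∈ ({u | u ≠ z} : Set V) := by
          refine mem_of_reachable (fun a b hab ha => ?_) hreach hzv.symm
          have h1 := hlow z hz _ (edgeGraph_adj.1 hab).1
          rintro rfl
          rcases Sym2.eq_iff.1 h1.1 with h2 | h2
          · exact h1.2 h2.2.symm
          · exact hzv h2.2
        exact this rfl
      by_cases hx : x = v
      · subst hx
        exact hnot y hf hact
      by_cases hy : y = v
      · subst hy
        rw [Sym2.eq_swap] at hf hact
        exact hnot x hf hact.symm
      -- Contracting `s(v, w)` turns a path that witnesses activity in `G` into one in `G - v`.
      let ρ : V → ({v}ᶜ : Set V) := fun z => if h : z = v then ⟨w, hwv⟩ else ⟨z, h⟩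
      have hρv : ρ v = ⟨w, hwv⟩ := by simp [ρ]
      have hρ : ∀ z (h : z ≠ v), ρ z = ⟨z, h⟩ := fun z h => by simp [ρ, h]
      refine hA.not_active s(ρ x, ρ y) ?_ ⟨_, _, rfl, reachable_map_of_adj ρ ?_ hact⟩
      · rw [hρ x hx, hρ y hy]
        simpa using hf
      · intro a b hab
        have hab1 := (edgeGraph_adj.1 hab).1
        rw [mem_filter, mem_insert, mem_map] at hab1
        obtain ⟨h1 | ⟨e, he, h1⟩, hlt⟩ := hab1
        · have : ρ a = ρ b := by
            rcases Sym2.eq_iff.1 h1 with ⟨rfl, rfl⟩ | ⟨rfl, rfl⟩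
            · rw [hρv, hρ _ hwv]
            · rw [hρv, hρ _ hwv]
          rw [this]
        · induction e using Sym2.ind with
          | _ c d =>
          have h2 : s(ρ a, ρ b) = s(c, d) := by
            apply ι.injective
            have ha : a ≠ v := by
              rintro rfl
              exact hι s(c, d) (h1 ▸ Sym2.mem_mk_left _ _)
            have hb : b ≠ v := by
              rintro rfl
              exact hι s(c, d) (h1 ▸ Sym2.mem_mk_right _ _)
            rw [h1, hρ a ha, hρ b hb]
            rfl
          apply reachable_of_mem
          rw [h2, mem_filter]
          refine ⟨he, ?_⟩
          simp only [Function.comp]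
          rw [h1, hρ x hx, hρ y hy]
          exact hlt
  · rintro ⟨w, A⟩ hp ⟨w', A'⟩ hp' h
    simp only at h
    have hw : w = w' := by
      have h1 : s(v, w) ∈ insert s(v, w') (A'.map ι) := h ▸ mem_insert_self _ _
      rw [mem_insert, mem_map] at h1
      rcases h1 with h1 | ⟨e, _, h1⟩
      · exact Sym2.congr_right.1 h1
      · exact absurd (h1 ▸ Sym2.mem_mk_left v w) (hι e)
    subst hw
    have hnot : ∀ B : Finset (Sym2 ({v}ᶜ : Set V)), s(v, w) ∉ B.map ι := by
      intro B hB
      obtain ⟨e, _, h1⟩ := mem_map.1 hB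
      exact absurd (h1 ▸ Sym2.mem_mk_left v w) (hι e)
    have h1 := congrArg (fun B => B.erase s(v, w)) h
    simp only [erase_insert (hnot _)] at h1
    rw [map_injective ι h1]

/-- Induction by deleting a vertex `v` that leaves the graph connected: the number for `G` is at
least the degree of `v` times that for `G - v`. This suffices except for the bound 4 when `v` has
degree 3 and `G - v` is a tree. -/
theorem nbcNumber_bounds (k : ℕ) : ∀ (V : Type) [Fintype V] (G : SimpleGraph V),
    Fintype.card V = k → G.Connected → 1 ≤ nbcNumber G ∧ (k ≤ #(edges G) → 2 ≤ nbcNumber G) ∧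
      (k + 1 ≤ #(edges G) → 4 ≤ nbcNumber G) := by
  induction k with
  | zero =>
    intro V _ G hV hG
    have := hG.nonempty
    exact absurd hV Fintype.card_ne_zero
  | succ k ih =>
    intro V _ G hV hG
    classical
    rcases subsingleton_or_nontrivial V with hs | hs
    · have hk : k = 0 := by
        have := Fintype.card_le_one_iff_subsingleton.2 hs
        omega
      have hE : edges G = ∅ := by
        ext e
        induction e using Sym2.ind with
        | _ x y =>
        simp only [mem_edges, mem_edgeSet, notMem_empty, iff_false]
        exact fun h => h.ne (Subsingleton.elim _ _)
      subst hk
      refine ⟨card_pos.2 ⟨∅, mem_nbcTrees.2 ⟨empty_subset _, ?_, ?_⟩⟩, ?_, ?_⟩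
      · have := hG.nonempty
        exact ⟨fun x y => by rw [Subsingleton.elim x y]⟩
      · simp [hE]
      · simp [hE]
      · simp [hE]
    · have hdel : ∀ v, (G.induce {v}ᶜ).Connected → Fintype.card ({v}ᶜ : Set V) = k ∧
          1 ≤ (G.neighborSet v).ncard := by
        intro v hv
        refine ⟨?_, ?_⟩
        · rw [Fintype.card_compl_set, hV]
          simp
        · obtain ⟨u, hu⟩ := hG.preconnected.exists_adj_of_nontrivial v
          exact (Set.ncard_pos (Set.toFinite _)).2 ⟨u, hu⟩
      obtain ⟨v, hv⟩ := hG.exists_connected_induce_compl_singleton_of_finite_nontrivial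
      obtain ⟨hk, hd⟩ := hdel v hv
      obtain ⟨h1, h2, h4⟩ := ih _ (G.induce {v}ᶜ) hk hv
      have hmul := degree_mul_nbcNumber_le G v
      have hcard := card_edges_induce_compl_singleton G v
      set d := (G.neighborSet v).ncard
      refine ⟨by nlinarith, fun hE => ?_, fun hE => ?_⟩
      · by_cases hd1 : d = 1
        · have := h2 (by omega)
          nlinarith
        · have : 2 ≤ d := by omega
          nlinarith
      · by_cases hd1 : d = 1
        · have := h4 (by omega)
          nlinarith
        by_cases hd2 : d = 2
        · have := h2 (by omega)
          rw [hd2] at hmul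
          omega
        by_cases hd4 : 4 ≤ d
        · nlinarith
        have hd3 : d = 3 := by omega
        by_cases hE' : k ≤ #(edges (G.induce {v}ᶜ))
        · have := h2 hE'
          nlinarith
        have htree : (G.induce {v}ᶜ).IsTree := by
          refine isTree_iff_connected_and_card.2 ⟨hv, ?_⟩
          have h5 : Nat.card (G.induce {v}ᶜ).edgeSet = #(edges (G.induce {v}ᶜ)) := by
            rw [Nat.card_coe_set_eq, Set.ncard_eq_toFinset_card _ (Set.toFinite _)]
            rfl
          have h6 := hv.card_vert_le_card_edgeSet_add_one
          have h7 : Nat.card ({v}ᶜ : Set V) = k := by rw [Nat.card_eq_fintype_card, hk]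
          omega
        have hlt : d < Fintype.card V := by
          refine lt_of_le_of_lt (Set.ncard_le_ncard (t := {v}ᶜ) (fun u hu => ?_)) ?_
          · exact (G.ne_of_adj hu).symm
          · rw [Set.ncard_compl, Set.ncard_singleton, Nat.card_eq_fintype_card]
            omega
        have hnt : Nontrivial ({v}ᶜ : Set V) := by
          rw [← Fintype.one_lt_card_iff_nontrivial]
          omega
        -- In the exceptional case a leaf `l` of the tree is deleted instead of `v`. It has degree
        -- at most 2 in `G`, and `G - l` is connected because `v` keeps a neighbour `u ≠ l`.
        obtain ⟨l, hl⟩ := htree.exists_vert_degree_one_of_nontrivial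
        have hl1 : ((G.induce {v}ᶜ).neighborSet l).ncard = 1 := by
          rw [Set.ncard_eq_toFinset_card', ← hl, ← card_neighborFinset_eq_degree]
          rfl
        have hsub : G.neighborSet l ⊆ insert v (Subtype.val '' (G.induce {v}ᶜ).neighborSet l) := by
          intro u hu
          by_cases huv : u = v
          · exact Or.inl huv
          · exact Or.inr ⟨⟨u, huv⟩, hu, rfl⟩
        have hle : (G.neighborSet l).ncard ≤ 2 := by
          refine (Set.ncard_le_ncard hsub).trans ((Set.ncard_insert_le _ _).trans ?_)
          rw [Set.ncard_image_of_injective _ Subtype.val_injective, hl1]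
        have hcon := hv.induce_compl_singleton_of_degree_eq_one hl
        obtain ⟨u, hu, hul⟩ : ∃ u ∈ G.neighborSet v, u ≠ l :=
          Set.exists_ne_of_one_lt_ncard (show 1 < d by omega) _
        have hreach : ∀ x y : ({(l : V)}ᶜ : Set V), (x : V) ≠ v → (y : V) ≠ v →
            (G.induce {(l : V)}ᶜ).Reachable x y := by
          intro x y hx hy
          let φ : ((G.induce {v}ᶜ).induce {l}ᶜ) →g (G.induce {(l : V)}ᶜ) :=
            ⟨fun z => ⟨z.1.1, fun h => z.2 (Subtype.ext h)⟩, fun h => h⟩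
          exact (hcon.preconnected ⟨⟨x, hx⟩, fun h => x.2 (congrArg Subtype.val h)⟩
            ⟨⟨y, hy⟩, fun h => y.2 (congrArg Subtype.val h)⟩).map φ
        have huv : u ≠ v := (G.ne_of_adj hu).symm
        have hconl : (G.induce {(l : V)}ᶜ).Connected := by
          rw [connected_iff_exists_forall_reachable]
          refine ⟨⟨u, hul⟩, fun x => ?_⟩
          by_cases hx : (x : V) = v
          · refine Adj.reachable ?_
            rw [comap_adj]
            change G.Adj u x
            rw [hx]
            exact G.adj_symm hu
          · exact hreach _ _ huv hx
        obtain ⟨hkl, hdl⟩ := hdel _ hconl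
        obtain ⟨g1, g2, g4⟩ := ih _ (G.induce {(l : V)}ᶜ) hkl hconl
        have hmul' := degree_mul_nbcNumber_le G l
        have hcard' := card_edges_induce_compl_singleton G l
        set d' := (G.neighborSet (l : V)).ncard
        by_cases hd' : d' = 1
        · have := g4 (by omega)
          nlinarith
        · have := g2 (by omega)
          have : d' = 2 := by omega
          rw [this] at hmul'
          omega

end VertexDeletion

/-! ### CNATs as spanning trees of the inversion graph -/

section Trees

open Finset SimpleGraph

variable {n : ℕ}

/-- The graph of the inversions of a permutation. -/
def inversionGraph (π : Equiv.Perm (Fin n)) : SimpleGraph (Fin n) where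
  Adj x y := (x < y ∧ π y < π x) ∨ (y < x ∧ π x < π y)
  symm := ⟨fun _ _ h => h.symm⟩
  loopless := ⟨fun _ h => h.elim (fun h => lt_irrefl _ h.1) (fun h => lt_irrefl _ h.1)⟩

theorem inversionGraph_adj {π : Equiv.Perm (Fin n)} {x y : Fin n} :
    (inversionGraph π).Adj x y ↔ (x < y ∧ π y < π x) ∨ (y < x ∧ π x < π y) := Iff.rfl

theorem mem_edges_inversionGraph {π : Equiv.Perm (Fin n)} {x y : Fin n} :
    s(x, y) ∈ edges (inversionGraph π) ↔ (x < y ∧ π y < π x) ∨ (y < x ∧ π x < π y) := by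
  simp [inversionGraph_adj]

theorem exists_of_mem_edges {π : Equiv.Perm (Fin n)} {e : Sym2 (Fin n)}
    (he : e ∈ edges (inversionGraph π)) : ∃ x y, e = s(x, y) ∧ x < y ∧ π y < π x := by
  induction e using Sym2.ind with
  | _ x y =>
  rcases mem_edges_inversionGraph.1 he with h | h
  · exact ⟨x, y, rfl, h⟩
  · exact ⟨y, x, Sym2.eq_swap, h⟩

/-- The cells of the inversions are ordered by columns and then by rows, from right to left and
from bottom to top. -/
def cellOrder (π : Equiv.Perm (Fin n)) (e : Sym2 (Fin n)) : (Fin n ×ₗ Fin n)ᵒᵈ :=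
  OrderDual.toDual (toLex (e.inf, (e.map π).inf))

theorem cellOrder_mk {π : Equiv.Perm (Fin n)} {x y : Fin n} (h1 : x < y) (h2 : π y < π x) :
    cellOrder π s(x, y) = OrderDual.toDual (toLex (x, π y)) := by
  simp [cellOrder, h1.le, h2.le]

theorem cellOrder_injOn (π : Equiv.Perm (Fin n)) :
    Set.InjOn (cellOrder π) (edges (inversionGraph π)) := by
  intro e he f hf h
  obtain ⟨x, y, rfl, h1, h2⟩ := exists_of_mem_edges he
  obtain ⟨z, w, rfl, h3, h4⟩ := exists_of_mem_edges hf
  rw [cellOrder_mk h1 h2, cellOrder_mk h3 h4] at h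
  have h5 := Prod.ext_iff.1 (toLex.injective (OrderDual.toDual.injective h))
  rw [show x = z from h5.1, show y = w from π.injective h5.2]

theorem cellOrder_lt {π : Equiv.Perm (Fin n)} {x y z w : Fin n} (h1 : x < y) (h2 : π y < π x)
    (h3 : z < w) (h4 : π w < π z) :
    cellOrder π s(x, y) < cellOrder π s(z, w) ↔ z < x ∨ (z = x ∧ π w < π y) := by
  rw [cellOrder_mk h1 h2, cellOrder_mk h3 h4, OrderDual.toDual_lt_toDual, Prod.Lex.lt_iff]
  rfl

/-- The dots of `T` that are reached from dots in `S` by steps to the right and downwards. -/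
inductive Descendant (T : Finset (Fin n × Fin n)) (S : Set (Fin n × Fin n)) :
    Fin n → Fin n → Prop
  | base {x y : Fin n} : (x, y) ∈ S → Descendant T S x y
  | right {x y x' : Fin n} : Descendant T S x y → x < x' → (x', y) ∈ T → Descendant T S x' y
  | down {x y y' : Fin n} : Descendant T S x y → y < y' → (x, y') ∈ T → Descendant T S x y'

theorem Descendant.exists_le {T : Finset (Fin n × Fin n)} {S : Set (Fin n × Fin n)} {x y : Fin n}
    (h : Descendant T S x y) : ∃ s ∈ S, s.1 ≤ x ∧ s.2 ≤ y := by
  induction h with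
  | base h => exact ⟨_, h, le_rfl, le_rfl⟩
  | right _ hlt _ ih =>
    obtain ⟨s, hs, h1, h2⟩ := ih
    exact ⟨s, hs, h1.trans hlt.le, h2⟩
  | down _ hlt _ ih =>
    obtain ⟨s, hs, h1, h2⟩ := ih
    exact ⟨s, hs, h1, h2.trans hlt.le⟩

theorem Descendant.mem {T : Finset (Fin n × Fin n)} {S : Set (Fin n × Fin n)} {x y : Fin n}
    (hST : ∀ s ∈ S, s ∈ T) (h : Descendant T S x y) : (x, y) ∈ T := by
  cases h with
  | base h => exact hST _ h
  | right _ _ h => exact h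
  | down _ _ h => exact h

/-- No dot has both a dot above it and a dot to its left. -/
def NoTwoParents (T : Finset (Fin n × Fin n)) : Prop :=
  ∀ d ∈ T, ¬ (HasDotAbove T d ∧ HasDotLeft T d)

/-- In `D`, the set of descendants of `S` is closed under passing to dots above or to the left if
this holds for `S`. -/
theorem Descendant.backward {T : Finset (Fin n × Fin n)} {S : Set (Fin n × Fin n)}
    (hT : NoTwoParents T) (hST : ∀ s ∈ S, s ∈ T) (D : Set (Fin n × Fin n))
    (hup : ∀ x y y', (x, y) ∈ S → y' < y → (x, y') ∈ T → (x, y') ∈ D → (x, y') ∈ S)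
    (hleft : ∀ x x' y, (x, y) ∈ S → x' < x → (x', y) ∈ T → (x', y) ∈ D → (x', y) ∈ S)
    {x y : Fin n} (h : Descendant T S x y) :
    (∀ y' < y, (x, y') ∈ T → (x, y') ∈ D → Descendant T S x y') ∧
      (∀ x' < x, (x', y) ∈ T → (x', y) ∈ D → Descendant T S x' y) := by
  induction h with
  | base h =>
    exact ⟨fun y' hy h1 h2 => .base (hup _ _ _ h hy h1 h2),
      fun x' hx h1 h2 => .base (hleft _ _ _ h hx h1 h2)⟩
  | @right x y x' h hlt hmem ih =>
    refine ⟨fun y' hy h1 h2 => ?_, fun x'' hx h1 h2 => ?_⟩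
    · exact absurd ⟨⟨y', hy, h1⟩, ⟨x, hlt, h.mem hST⟩⟩ (hT _ hmem)
    · rcases lt_trichotomy x'' x with h3 | rfl | h3
      · exact ih.2 _ h3 h1 h2
      · exact h
      · exact h.right h3 h1
  | @down x y y' h hlt hmem ih =>
    refine ⟨fun y'' hy h1 h2 => ?_, fun x' hx h1 h2 => ?_⟩
    · rcases lt_trichotomy y'' y with h3 | rfl | h3
      · exact ih.1 _ h3 h1 h2
      · exact h
      · exact h.down h3 h1
    · exact absurd ⟨⟨y, hlt, h.mem hST⟩, ⟨x', hx, h1⟩⟩ (hT _ hmem)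

/-- The dots with leaf dots `π` and with an inner dot for every inversion in `A`. -/
def dotSet (π : Equiv.Perm (Fin n)) (A : Finset (Sym2 (Fin n))) : Finset (Fin n × Fin n) :=
  univ.filter (fun d => π d.1 = d.2 ∨ (d.1 < π.symm d.2 ∧ s(d.1, π.symm d.2) ∈ A))

theorem mem_dotSet {π : Equiv.Perm (Fin n)} {A : Finset (Sym2 (Fin n))} {x y : Fin n} :
    (x, π y) ∈ dotSet π A ↔ x = y ∨ (x < y ∧ s(x, y) ∈ A) := by
  simp [dotSet]

/-- The inner dot of the edge shares its column with one of the two leaf dots and its row with the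
other. From either leaf dot `Descendant.backward` leads back to this dot, and one step down or right
leads to the other leaf dot. -/
theorem descendant_closed {π : Equiv.Perm (Fin n)} {A : Finset (Sym2 (Fin n))}
    (hA : A ⊆ edges (inversionGraph π)) {S : Set (Fin n × Fin n)}
    (hT : NoTwoParents (dotSet π A)) (hST : ∀ s ∈ S, s ∈ dotSet π A) (D : Set (Fin n × Fin n))
    (hup : ∀ x y y', (x, y) ∈ S → y' < y → (x, y') ∈ dotSet π A → (x, y') ∈ D → (x, y') ∈ S)
    (hleft : ∀ x x' y, (x, y) ∈ S → x' < x → (x', y) ∈ dotSet π A → (x', y) ∈ D → (x', y) ∈ S)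
    {x y : Fin n} (hxy : x < y) (hA' : s(x, y) ∈ A) (hD : (x, π y) ∈ D) :
    Descendant (dotSet π A) S x (π x) ↔ Descendant (dotSet π A) S y (π y) := by
  have hinv : π y < π x := by
    rcases mem_edges_inversionGraph.1 (hA hA') with h | h
    · exact h.2
    · exact absurd h.1 hxy.asymm
  have hmem : (x, π y) ∈ dotSet π A := mem_dotSet.2 (Or.inr ⟨hxy, hA'⟩)
  have hback := @Descendant.backward n _ S hT hST D hup hleft
  constructor
  · intro h
    exact ((hback h).1 _ hinv hmem hD).right hxy (mem_dotSet.2 (Or.inl rfl))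
  · intro h
    exact ((hback h).2 _ hxy hmem hD).down hinv (mem_dotSet.2 (Or.inl rfl))

/-- The edges smaller than that of the cell `(c, π w)` have their cells in `D`: in later columns, or
lower in column `c`. Along such edges, the leaf dot of column `c` only reaches descendants of dots
of that column below row `π w`, and the leaf dot in row `π w` is not among them. -/
theorem not_isActive_of_noTwoParents {π : Equiv.Perm (Fin n)} {A : Finset (Sym2 (Fin n))}
    (hA : A ⊆ edges (inversionGraph π)) (hT : NoTwoParents (dotSet π A)) :
    ∀ e ∈ edges (inversionGraph π), ¬ IsActive (cellOrder π) A e := by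
  intro e he hact
  obtain ⟨c, w, rfl, hcw, hwc⟩ := exists_of_mem_edges he
  rw [isActive_mk] at hact
  let S : Set (Fin n × Fin n) := {d | d ∈ dotSet π A ∧ d.1 = c ∧ π w < d.2}
  let D : Set (Fin n × Fin n) := {d | c < d.1 ∨ (c = d.1 ∧ π w < d.2)}
  have hclosed := @descendant_closed n π A hA S hT (fun s hs => hs.1) D (by
      rintro x y y' ⟨_, rfl, _⟩ _ h3 h4
      rcases h4 with h4 | h4
      · exact absurd h4 (lt_irrefl _)
      · exact ⟨h3, rfl, h4.2⟩) (by
      rintro x x' y ⟨_, rfl, _⟩ h2 h3 h4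
      rcases h4 with h4 | h4
      · exact absurd h4 h2.asymm
      · exact absurd h4.1 h2.ne')
  have hw : w ∈ {v | Descendant (dotSet π A) S v (π v)} := by
    refine mem_of_reachable (fun a b hab ha => ?_) hact (.base ⟨mem_dotSet.2 (Or.inl rfl), rfl, hwc⟩)
    have hab' := mem_filter.1 (edgeGraph_adj.1 hab).1
    rcases mem_edges_inversionGraph.1 (hA hab'.1) with ⟨h1, h2⟩ | ⟨h1, h2⟩
    · exact (hclosed h1 hab'.1 ((cellOrder_lt h1 h2 hcw hwc).1 hab'.2)).1 ha
    · rw [Sym2.eq_swap] at hab'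
      exact (hclosed h1 hab'.1 ((cellOrder_lt h1 h2 hcw hwc).1 hab'.2)).2 ha
  obtain ⟨s, hs, _, h2⟩ := Descendant.exists_le hw
  exact absurd hs.2.2 h2.not_gt

/-- A dot with two parents spans a rectangle with them. The top-left corner of the rectangle is the
cell of an inversion that follows all three in `cellOrder`, and the three dots join its ends. -/
theorem noTwoParents_of_not_isActive {π : Equiv.Perm (Fin n)} {A : Finset (Sym2 (Fin n))}
    (hA : A ⊆ edges (inversionGraph π))
    (h : ∀ e ∈ edges (inversionGraph π), ¬ IsActive (cellOrder π) A e) :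
    NoTwoParents (dotSet π A) := by
  rintro ⟨x, y'⟩ hd ⟨⟨z', hz, hzT⟩, ⟨w, hw, hwT⟩⟩
  obtain ⟨y, rfl⟩ := π.surjective y'
  obtain ⟨z, rfl⟩ := π.surjective z'
  simp only at hz hzT hw hwT
  have hinv : ∀ {a b}, (a, π b) ∈ dotSet π A → a ≠ b → a < b ∧ π b < π a ∧ s(a, b) ∈ A := by
    intro a b hab hne
    rcases mem_dotSet.1 hab with h1 | ⟨h1, h2⟩
    · exact absurd h1 hne
    · rcases mem_edges_inversionGraph.1 (hA h2) with h | h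
      · exact ⟨h1, h.2, h2⟩
      · exact absurd h.1 h1.asymm
  have hxy : x ≤ y := by
    rcases mem_dotSet.1 hd with h1 | ⟨h1, _⟩
    exacts [h1.le, h1.le]
  have hyx : π y ≤ π x := by
    by_cases hxy : x = y
    · rw [hxy]
    · exact (hinv hd hxy).2.1.le
  obtain ⟨hxz, hzx, hxzA⟩ := hinv hzT (by rintro rfl; exact absurd hz hyx.not_gt)
  obtain ⟨hwy, hyw, hwyA⟩ := hinv hwT (by rintro rfl; exact absurd hw hxy.not_gt)
  have hwz : w < z := hw.trans hxz
  have hzw : π z < π w := hz.trans hyw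
  refine h s(w, z) (mem_edges_inversionGraph.2 (Or.inl ⟨hwz, hzw⟩)) (isActive_mk.2 ?_)
  have h1 : s(w, y) ∈ A.filter (fun f => cellOrder π f < cellOrder π s(w, z)) :=
    mem_filter.2 ⟨hwyA, (cellOrder_lt hwy hyw hwz hzw).2 (Or.inr ⟨rfl, hz⟩)⟩
  have h2 : s(x, z) ∈ A.filter (fun f => cellOrder π f < cellOrder π s(w, z)) :=
    mem_filter.2 ⟨hxzA, (cellOrder_lt hxz hzx hwz hzw).2 (Or.inl hw)⟩
  refine (reachable_of_mem h1).trans (Reachable.trans ?_ (reachable_of_mem h2))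
  -- If the dot is a leaf dot, it contributes no edge, but then the two remaining edges already
  -- meet.
  by_cases hxy' : x = y
  · rw [hxy']
  · obtain ⟨h3, h4, h5⟩ := hinv hd hxy'
    exact (reachable_of_mem (mem_filter.2 ⟨h5, (cellOrder_lt h3 h4 hwz hzw).2 (Or.inl hw)⟩)).symm

/-- By connectedness every leaf dot descends from a parentless dot, so those in the first column and
in the first row do too; descendants never lie to the left of it or above it. -/
theorem eq_zero_of_no_parent {π : Equiv.Perm (Fin n)} {A : Finset (Sym2 (Fin n))}
    (hA : A ⊆ edges (inversionGraph π)) (hT : NoTwoParents (dotSet π A))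
    (hc : (edgeGraph A).Connected) {d : Fin n × Fin n} (hd : d ∈ dotSet π A)
    (h1 : ¬ HasDotAbove (dotSet π A) d) (h2 : ¬ HasDotLeft (dotSet π A) d) :
    (d.1 : ℕ) = 0 ∧ (d.2 : ℕ) = 0 := by
  obtain ⟨x, y'⟩ := d
  obtain ⟨y, rfl⟩ := π.surjective y'
  have hclosed := @descendant_closed n π A hA {(x, π y)} hT (by simpa using hd) Set.univ (by
      intro a b b' hab hlt h3 _
      rw [Set.mem_singleton_iff, Prod.mk.injEq] at hab
      obtain ⟨rfl, rfl⟩ := hab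
      exact absurd ⟨b', hlt, h3⟩ h1) (by
      intro a a' b hab hlt h3 _
      rw [Set.mem_singleton_iff, Prod.mk.injEq] at hab
      obtain ⟨rfl, rfl⟩ := hab
      exact absurd ⟨a', hlt, h3⟩ h2)
  have hall : ∀ v, v ∈ {v | Descendant (dotSet π A) {(x, π y)} v (π v)} := by
    intro v
    refine mem_of_reachable (fun a b hab ha => ?_) (hc.preconnected y v) ?_
    · have hab' := (edgeGraph_adj.1 hab).1
      rcases mem_edges_inversionGraph.1 (hA hab') with ⟨h1, _⟩ | ⟨h1, _⟩
      · exact (hclosed h1 hab' trivial).1 ha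
      · rw [Sym2.eq_swap] at hab'
        exact (hclosed h1 hab' trivial).2 ha
    · rcases mem_dotSet.1 hd with rfl | ⟨h3, _⟩
      · exact .base (Set.mem_singleton _)
      · exact (Descendant.base (Set.mem_singleton _)).right h3 (mem_dotSet.2 (Or.inl rfl))
  have hpos : 0 < n := x.pos
  constructor
  · obtain ⟨s, rfl, h3, _⟩ := (hall ⟨0, hpos⟩).exists_le
    exact Nat.le_zero.1 h3
  · obtain ⟨s, rfl, _, h3⟩ := (hall (π.symm ⟨0, hpos⟩)).exists_le
    rw [Equiv.apply_symm_apply] at h3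
    exact Nat.le_zero.1 h3

theorem dotSet_mem_CNATSet {π : Equiv.Perm (Fin n)} {A : Finset (Sym2 (Fin n))}
    (hA : IsNBC (cellOrder π) (edges (inversionGraph π)) A) : dotSet π A ∈ CNATSet π := by
  have hT := noTwoParents_of_not_isActive hA.subset hA.not_active
  have hleaf : ∀ x, (x, π x) ∈ dotSet π A := fun x => mem_dotSet.2 (Or.inl rfl)
  have hle : ∀ x y, (x, π y) ∈ dotSet π A → x = y ∨ (x < y ∧ π y < π x) := by
    intro x y h
    rcases mem_dotSet.1 h with h1 | ⟨h1, h2⟩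
    · exact Or.inl h1
    · rcases mem_edges_inversionGraph.1 (hA.subset h2) with h | h
      · exact Or.inr h
      · exact absurd h.1 h1.asymm
  have hbelow : ∀ x, ¬ HasDotBelow (dotSet π A) (x, π x) := by
    rintro x ⟨r, h1, h2⟩
    obtain ⟨y, rfl⟩ := π.surjective r
    rcases hle _ _ h2 with rfl | h
    · exact lt_irrefl _ h1
    · exact absurd h1 h.2.asymm
  have hright : ∀ x, ¬ HasDotRight (dotSet π A) (x, π x) := by
    rintro x ⟨c, h1, h2⟩
    rcases hle _ _ h2 with rfl | h
    · exact lt_irrefl _ h1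
    · exact absurd h1 h.1.asymm
  refine ⟨⟨⟨fun c => ⟨π c, hleaf c⟩, fun r => ?_, fun d hd h0 => ?_⟩, ?_⟩, ?_⟩
  · obtain ⟨y, rfl⟩ := π.surjective r
    exact ⟨y, hleaf y⟩
  · by_cases h1 : HasDotAbove (dotSet π A) d
    · exact Or.inl ⟨h1, fun h2 => hT d hd ⟨h1, h2⟩⟩
    · exact Or.inr ⟨by_contra fun h2 => h0 (eq_zero_of_no_parent hA.subset hT hA.connected hd h1 h2),
        h1⟩
  · rintro ⟨x, r⟩ hd
    obtain ⟨y, rfl⟩ := π.surjective r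
    rcases hle _ _ hd with rfl | h
    · exact iff_of_false (hbelow _) (hright _)
    · exact iff_of_true ⟨π x, h.2, hleaf x⟩ ⟨y, h.1, hleaf y⟩
  · rintro ⟨x, r⟩
    obtain ⟨y, rfl⟩ := π.surjective r
    constructor
    · rintro ⟨hd, h1, _⟩
      rcases hle _ _ hd with rfl | h
      · rfl
      · exact absurd ⟨π x, h.2, hleaf x⟩ h1
    · intro h
      obtain rfl : x = y := π.injective h
      exact ⟨hleaf x, hbelow x, hright x⟩

theorem exists_dotSet_eq {π : Equiv.Perm (Fin n)} (hn : 0 < n) {T : Finset (Fin n × Fin n)}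
    (hT : T ∈ CNATSet π) :
    ∃ A, IsNBC (cellOrder π) (edges (inversionGraph π)) A ∧ dotSet π A = T := by
  obtain ⟨hC, hL⟩ := hT
  -- The lowest dot of a column is a leaf dot by completeness, so all dots of the column lie weakly
  -- above the leaf dot.
  have hcol : ∀ c r, (c, r) ∈ T → r ≤ π c := by
    intro c r h
    obtain ⟨m, hm, hmax⟩ := exists_max_image (univ.filter (fun r => (c, r) ∈ T)) id
      ⟨r, by simpa using h⟩
    rw [mem_filter] at hm
    have hb : ¬ HasDotBelow T (c, m) := by
      rintro ⟨r', h1, h2⟩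
      exact absurd (hmax r' (by simpa using h2)) h1.not_ge
    have := (hL (c, m)).1 ⟨hm.2, hb, fun h' => hb ((hC.complete _ hm.2).2 h')⟩
    rw [show π c = m from this]
    exact hmax r (by simpa using h)
  have hrow : ∀ c r, (c, r) ∈ T → c ≤ π.symm r := by
    intro c r h
    obtain ⟨m, hm, hmax⟩ := exists_max_image (univ.filter (fun c => (c, r) ∈ T)) id
      ⟨c, by simpa using h⟩
    rw [mem_filter] at hm
    have hb : ¬ HasDotRight T (m, r) := by
      rintro ⟨r', h1, h2⟩
      exact absurd (hmax r' (by simpa using h2)) h1.not_ge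
    have := (hL (m, r)).1 ⟨hm.2, fun h' => hb ((hC.complete _ hm.2).1 h'), hb⟩
    rw [← show π m = r from this, Equiv.symm_apply_apply]
    exact hmax c (by simpa using h)
  have hleaf : ∀ x, (x, π x) ∈ T := fun x => ((hL (x, π x)).2 rfl).1
  have hinv : ∀ x y, (x, π y) ∈ T → x = y ∨ (x < y ∧ π y < π x) := by
    intro x y h
    by_cases hxy : x = y
    · exact Or.inl hxy
    · have h1 := hcol _ _ h
      have h2 := hrow _ _ h
      rw [Equiv.symm_apply_apply] at h2
      exact Or.inr ⟨lt_of_le_of_ne h2 hxy, lt_of_le_of_ne h1 fun h' => hxy (π.injective h').symm⟩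
  classical
  let A : Finset (Sym2 (Fin n)) :=
    (edges (inversionGraph π)).filter (fun e => ∃ x y, x < y ∧ (x, π y) ∈ T ∧ e = s(x, y))
  have hmemA : ∀ x y, x < y → (s(x, y) ∈ A ↔ (x, π y) ∈ T) := by
    intro x y hxy
    simp only [A, mem_filter]
    constructor
    · rintro ⟨_, x', y', h1, h2, h3⟩
      rcases Sym2.eq_iff.1 h3 with ⟨rfl, rfl⟩ | ⟨rfl, rfl⟩
      · exact h2
      · exact absurd h1 hxy.asymm
    · intro h
      refine ⟨mem_edges_inversionGraph.2 (Or.inl ?_), x, y, hxy, h, rfl⟩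
      exact (hinv _ _ h).resolve_left hxy.ne
  have hAT : dotSet π A = T := by
    ext ⟨x, r⟩
    obtain ⟨y, rfl⟩ := π.surjective r
    rw [mem_dotSet]
    constructor
    · rintro (rfl | ⟨h1, h2⟩)
      · exact hleaf _
      · exact (hmemA _ _ h1).1 h2
    · intro h
      rcases hinv _ _ h with h1 | h1
      · exact Or.inl h1
      · exact Or.inr ⟨h1.1, (hmemA _ _ h1.1).2 h⟩
  have hAsub : A ⊆ edges (inversionGraph π) := filter_subset _ _
  have hadj : ∀ x y, (x, π y) ∈ T → (edgeGraph A).Reachable x y := by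
    intro x y h
    rcases hinv _ _ h with rfl | h1
    · exact Reachable.refl _
    · exact reachable_of_mem ((hmemA _ _ h1.1).2 h)
  refine ⟨A, ⟨hAsub, ?_, not_isActive_of_noTwoParents hAsub ?_⟩, hAT⟩
  · have key : ∀ k x y, (x, π y) ∈ T → (x : ℕ) + π y = k →
        (edgeGraph A).Reachable ⟨0, hn⟩ x := by
      intro k
      induction k using Nat.strong_induction_on with
      | _ k ih =>
      intro x y h hk
      by_cases h0 : (x : ℕ) = 0 ∧ (π y : ℕ) = 0
      · rw [show x = ⟨0, hn⟩ from Fin.ext h0.1]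
      · rcases hC.unique_parent _ h h0 with ⟨⟨r, h1, h2⟩, _⟩ | ⟨⟨c, h1, h2⟩, _⟩
        · obtain ⟨z, rfl⟩ := π.surjective r
          have h1' : (π z : ℕ) < π y := h1
          exact ih _ (by omega) x z h2 rfl
        · have h1' : (c : ℕ) < x := h1
          exact ((ih _ (by omega) c y h2 rfl).trans (hadj _ _ h2)).trans (hadj _ _ h).symm
    rw [connected_iff_exists_forall_reachable]
    exact ⟨⟨0, hn⟩, fun x => key _ x x (hleaf x) rfl⟩
  · rw [hAT]
    intro d hd h
    by_cases h0 : (d.1 : ℕ) = 0 ∧ (d.2 : ℕ) = 0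
    · obtain ⟨r, h1, _⟩ := h.1
      have h1' : (r : ℕ) < d.2 := h1
      omega
    · rcases hC.unique_parent _ hd h0 with h1 | h1
      · exact h1.2 h.2
      · exact h1.2 h.1

theorem cnat_eq_nbcNumber (π : Equiv.Perm (Fin n)) (hn : 0 < n) :
    cnat π = nbcNumber (inversionGraph π) := by
  rw [nbcNumber_eq (cellOrder_injOn π), cnat, ← Set.ncard_coe_finset]
  symm
  refine Set.ncard_congr (fun A _ => dotSet π A) ?_ ?_ ?_
  · intro A hA
    exact dotSet_mem_CNATSet (mem_nbcTrees.1 hA)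
  · intro A B hA hB h
    have hle : ∀ A B, IsNBC (cellOrder π) (edges (inversionGraph π)) A → dotSet π A = dotSet π B →
        A ⊆ B := by
      intro A B hA h e he
      obtain ⟨x, y, rfl, h1, h2⟩ := exists_of_mem_edges (hA.subset he)
      have h3 : (x, π y) ∈ dotSet π A := mem_dotSet.2 (Or.inr ⟨h1, he⟩)
      rw [h, mem_dotSet] at h3
      exact (h3.resolve_left h1.ne).2
    exact (hle A B (mem_nbcTrees.1 hA) h).antisymm (hle B A (mem_nbcTrees.1 hB) h.symm)
  · intro T hT
    obtain ⟨A, hA, hAT⟩ := exists_dotSet_eq hn hT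
    exact ⟨A, mem_nbcTrees.2 hA, hAT⟩

end Trees

/-! ### Unicyclic graphs with a triangle or a square -/

section Unicyclic

open Finset SimpleGraph

theorem isBridgeless_triangle {V : Type*} [DecidableEq V] {a b c : V} (hab : a ≠ b) (hbc : b ≠ c)
    (hca : c ≠ a) : IsBridgeless {s(a, b), s(b, c), s(c, a)} := by
  intro A hCA hA e he
  have h1 : s(a, b) ∈ A := hCA (by simp)
  have h2 : s(b, c) ∈ A := hCA (by simp)
  have h3 : s(c, a) ∈ A := hCA (by simp)
  simp only [mem_insert, mem_singleton] at he
  rcases he with rfl | rfl | rfl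
  · exact connected_erase hA ((reachable_of_mem (y := c) (by grind)).trans
      (reachable_of_mem (by grind)))
  · exact connected_erase hA ((reachable_of_mem (y := a) (by grind)).trans
      (reachable_of_mem (by grind)))
  · exact connected_erase hA ((reachable_of_mem (y := b) (by grind)).trans
      (reachable_of_mem (by grind)))

theorem isBridgeless_square {V : Type*} [DecidableEq V] {a b c d : V} (hab : a ≠ b) (hbc : b ≠ c)
    (hcd : c ≠ d) (hda : d ≠ a) (hac : a ≠ c) (hbd : b ≠ d) :
    IsBridgeless {s(a, b), s(b, c), s(c, d), s(d, a)} := by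
  intro A hCA hA e he
  have h1 : s(a, b) ∈ A := hCA (by simp)
  have h2 : s(b, c) ∈ A := hCA (by simp)
  have h3 : s(c, d) ∈ A := hCA (by simp)
  have h4 : s(d, a) ∈ A := hCA (by simp)
  simp only [mem_insert, mem_singleton] at he
  rcases he with rfl | rfl | rfl | rfl
  · exact connected_erase hA (((reachable_of_mem (y := d) (by grind)).trans
      (reachable_of_mem (y := c) (by grind))).trans (reachable_of_mem (by grind)))
  · exact connected_erase hA (((reachable_of_mem (y := a) (by grind)).trans
      (reachable_of_mem (y := d) (by grind))).trans (reachable_of_mem (by grind)))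
  · exact connected_erase hA (((reachable_of_mem (y := b) (by grind)).trans
      (reachable_of_mem (y := a) (by grind))).trans (reachable_of_mem (by grind)))
  · exact connected_erase hA (((reachable_of_mem (y := c) (by grind)).trans
      (reachable_of_mem (y := b) (by grind))).trans (reachable_of_mem (by grind)))

/-- A connected graph with as many edges as vertices, i.e. with exactly one cycle. -/
structure IsUnicyclic {V : Type*} [Fintype V] (G : SimpleGraph V) : Prop where
  connected : G.Connected
  card_edges : #(edges G) = Fintype.card V

theorem isUnicyclic_of_nbcNumber {V : Type} [Fintype V] {G : SimpleGraph V}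
    (h2 : 2 ≤ nbcNumber G) (h3 : nbcNumber G ≤ 3) : IsUnicyclic G := by
  have hc := connected_of_nbcNumber_pos (show 0 < nbcNumber G by omega)
  refine ⟨hc, ?_⟩
  have h4 := (nbcNumber_bounds _ V G rfl hc).2.2
  by_contra hne
  rcases lt_or_gt_of_ne hne with h | h
  · have := nbcNumber_le_one h
    omega
  · have := h4 h
    omega

variable {V : Type*} [Fintype V] [DecidableEq V] {G : SimpleGraph V} {a b c d x : V}

theorem IsUnicyclic.nbcNumber_add_one (hG : IsUnicyclic G) :
    nbcNumber G + 1 = #(nonBridges (edges G)) := by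
  have h := hG.connected
  rw [← edgeGraph_edges G] at h
  have h2 := card_nbcTrees_add_one
    ((Equiv.injective _).injOn : Set.InjOn (Fintype.equivFin (Sym2 V)) (edges G)) h hG.card_edges
  rw [← h2]
  exact congrArg (· + 1) (nbcNumber_eq (Equiv.injective _).injOn)

theorem IsUnicyclic.eq_nonBridges (hG : IsUnicyclic G) {C : Finset (Sym2 V)} (hC : IsBridgeless C)
    (hCE : C ⊆ edges G) (hne : C.Nonempty) : C = nonBridges (edges G) := by
  have h := hG.connected
  rw [← edgeGraph_edges G] at h
  exact hC.eq_nonBridges h hCE hne hG.card_edges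

theorem IsUnicyclic.triangle (hG : IsUnicyclic G) (hab : G.Adj a b) (hbc : G.Adj b c)
    (hca : G.Adj c a) : {s(a, b), s(b, c), s(c, a)} = nonBridges (edges G) := by
  refine hG.eq_nonBridges (isBridgeless_triangle hab.ne hbc.ne hca.ne) ?_ ⟨_, mem_insert_self _ _⟩
  intro e he
  simp only [mem_insert, mem_singleton] at he
  rcases he with rfl | rfl | rfl
  all_goals simpa

theorem IsUnicyclic.square (hG : IsUnicyclic G) (hab : G.Adj a b) (hbc : G.Adj b c)
    (hcd : G.Adj c d) (hda : G.Adj d a) (hac : a ≠ c) (hbd : b ≠ d) :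
    {s(a, b), s(b, c), s(c, d), s(d, a)} = nonBridges (edges G) := by
  refine hG.eq_nonBridges (isBridgeless_square hab.ne hbc.ne hcd.ne hda.ne hac hbd) ?_
    ⟨_, mem_insert_self _ _⟩
  intro e he
  simp only [mem_insert, mem_singleton] at he
  rcases he with rfl | rfl | rfl | rfl
  all_goals simpa

theorem IsUnicyclic.nbcNumber_of_triangle (hG : IsUnicyclic G) (hab : G.Adj a b)
    (hbc : G.Adj b c) (hca : G.Adj c a) : nbcNumber G = 2 := by
  have h := hG.nbcNumber_add_one
  have h1 := hab.ne
  have h2 := hbc.ne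
  have h3 := hca.ne
  rw [← hG.triangle hab hbc hca, card_eq_three.2 ⟨_, _, _, by grind, by grind, by grind, rfl⟩] at h
  omega

theorem IsUnicyclic.nbcNumber_of_square (hG : IsUnicyclic G) (hab : G.Adj a b) (hbc : G.Adj b c)
    (hcd : G.Adj c d) (hda : G.Adj d a) (hac : a ≠ c) (hbd : b ≠ d) : nbcNumber G = 3 := by
  have h := hG.nbcNumber_add_one
  have h1 := hab.ne
  have h2 := hbc.ne
  have h3 := hcd.ne
  have h4 := hda.ne
  rw [← hG.square hab hbc hcd hda hac hbd, card_insert_of_notMem (by grind),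
    card_eq_three.2 ⟨_, _, _, by grind, by grind, by grind, rfl⟩] at h
  omega

/-- Otherwise there is also a triangle, and `nbcNumber` would be both 2 and 3. -/
theorem IsUnicyclic.not_adj_of_square_side (hG : IsUnicyclic G) (hab : G.Adj a b)
    (hbc : G.Adj b c) (hcd : G.Adj c d) (hda : G.Adj d a) (hac : a ≠ c) (hbd : b ≠ d)
    (hxa : G.Adj x a) : ¬ G.Adj x b := by
  intro hxb
  have h1 := hG.nbcNumber_of_square hab hbc hcd hda hac hbd
  have h2 := hG.nbcNumber_of_triangle hxa hab hxb.symm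
  omega

/-- Otherwise `x, a, b, c` form a second square, with an edge `s(x, a)` that is not in the first
one. -/
theorem IsUnicyclic.not_adj_of_square_diagonal (hG : IsUnicyclic G) (hab : G.Adj a b)
    (hbc : G.Adj b c) (hcd : G.Adj c d) (hda : G.Adj d a) (hac : a ≠ c) (hbd : b ≠ d)
    (hxb : x ≠ b) (hxd : x ≠ d) (hxa : G.Adj x a) : ¬ G.Adj x c := by
  intro hxc
  have h1 := hG.square hab hbc hcd hda hac hbd
  have h2 := hG.square hxa hab hbc hxc.symm hxb hac
  have h3 : s(x, a) ∈ ({s(a, b), s(b, c), s(c, d), s(d, a)} : Finset (Sym2 V)) := by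
    rw [h1, ← h2]
    exact mem_insert_self _ _
  have h4 := hxa.ne
  have h5 := hxc.ne
  clear h1 h2
  simp only [mem_insert, mem_singleton, Sym2.eq_iff] at h3
  grind

end Unicyclic

/-! ### Cycles in inversion graphs as patterns -/

section Patterns

open Finset SimpleGraph

variable {n : ℕ}

theorem isOccurrence_pattern321_iff {π : Equiv.Perm (Fin n)} {f : Fin 3 ↪o Fin n} :
    IsOccurrence pattern321 π f ↔ π (f 2) < π (f 1) ∧ π (f 1) < π (f 0) := by
  constructor
  · intro h
    exact ⟨(h 2 1).2 (by decide), (h 1 0).2 (by decide)⟩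
  · rintro ⟨h1, h2⟩ a b
    have h3 := h1.trans h2
    fin_cases a <;> fin_cases b <;>
      simp [pattern321, h1, h2, h3, h1.le, h2.le, h3.le]

theorem isOccurrence_pattern3412_iff {π : Equiv.Perm (Fin n)} {f : Fin 4 ↪o Fin n} :
    IsOccurrence pattern3412 π f ↔
      π (f 2) < π (f 3) ∧ π (f 3) < π (f 0) ∧ π (f 0) < π (f 1) := by
  constructor
  · intro h
    exact ⟨(h 2 3).2 (by decide), (h 3 0).2 (by decide), (h 0 1).2 (by decide)⟩
  · rintro ⟨h1, h2, h3⟩ a b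
    have h4 := h1.trans h2
    have h5 := h2.trans h3
    have h6 := h1.trans h5
    fin_cases a <;> fin_cases b <;>
      simp [pattern3412, h1, h2, h3, h4, h5, h6, h1.le, h2.le, h3.le, h4.le, h5.le, h6.le]

theorem isOccurrence_pattern4231_iff {π : Equiv.Perm (Fin n)} {f : Fin 4 ↪o Fin n} :
    IsOccurrence pattern4231 π f ↔
      π (f 3) < π (f 1) ∧ π (f 1) < π (f 2) ∧ π (f 2) < π (f 0) := by
  constructor
  · intro h
    exact ⟨(h 3 1).2 (by decide), (h 1 2).2 (by decide), (h 2 0).2 (by decide)⟩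
  · rintro ⟨h1, h2, h3⟩ a b
    have h4 := h1.trans h2
    have h5 := h2.trans h3
    have h6 := h1.trans h5
    fin_cases a <;> fin_cases b <;>
      simp [pattern4231, h1, h2, h3, h4, h5, h6, h1.le, h2.le, h3.le, h4.le, h5.le, h6.le]

/-- The order embedding with values `a < b < c`. -/
def orderEmbedding3 {a b c : Fin n} (hab : a < b) (hbc : b < c) : Fin 3 ↪o Fin n :=
  OrderEmbedding.ofStrictMono ![a, b, c] (by
    rw [Fin.strictMono_iff_lt_succ]
    intro i
    fin_cases i <;> simp [hab, hbc])

/-- The order embedding with values `a < b < c < d`. -/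
def orderEmbedding4 {a b c d : Fin n} (hab : a < b) (hbc : b < c) (hcd : c < d) :
    Fin 4 ↪o Fin n :=
  OrderEmbedding.ofStrictMono ![a, b, c, d] (by
    rw [Fin.strictMono_iff_lt_succ]
    intro i
    fin_cases i <;> simp [hab, hbc, hcd])

/-- If the dots of all inversions had no dot with two parents, the whole edge set would be a tree,
but it has one edge too many. A dot with two parents yields the letters of a 321 or a 3412. -/
theorem exists_pattern {π : Equiv.Perm (Fin n)} (h : IsUnicyclic (inversionGraph π)) :
    (∃ f, IsOccurrence pattern321 π f) ∨ ∃ f, IsOccurrence pattern3412 π f := by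
  have hT : ¬ NoTwoParents (dotSet π (edges (inversionGraph π))) := by
    intro hT
    have hc := h.connected
    rw [← edgeGraph_edges (inversionGraph π)] at hc
    have hnbc : IsNBC (cellOrder π) (edges (inversionGraph π)) (edges (inversionGraph π)) :=
      ⟨Subset.refl _, hc, not_isActive_of_noTwoParents (Subset.refl _) hT⟩
    have h1 := hnbc.card_add_one (cellOrder_injOn π)
    have h2 := h.card_edges
    omega
  rw [NoTwoParents] at hT
  push Not at hT
  obtain ⟨⟨x, y'⟩, hd, ⟨z', hz, hzT⟩, ⟨w, hw, hwT⟩⟩ := hT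
  obtain ⟨y, rfl⟩ := π.surjective y'
  obtain ⟨z, rfl⟩ := π.surjective z'
  simp only [mem_dotSet, mem_edges_inversionGraph] at hz hzT hw hwT hd
  have hxy : x = y ∨ (x < y ∧ π y < π x) := by grind
  have hxz : x < z ∧ π z < π x := by grind
  have hwy : w < y ∧ π y < π w := by grind
  rcases hxy with rfl | hxy
  · left
    exact ⟨orderEmbedding3 hw hxz.1, isOccurrence_pattern321_iff.2 ⟨hz, hwy.2⟩⟩
  rcases lt_trichotomy y z with h1 | rfl | h1
  · left
    exact ⟨orderEmbedding3 hxy.1 h1, isOccurrence_pattern321_iff.2 ⟨hz, hxy.2⟩⟩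
  · exact absurd hz (lt_irrefl _)
  · rcases lt_or_gt_of_ne (π.injective.ne hw.ne) with h2 | h2
    · right
      exact ⟨orderEmbedding4 hw hxz.1 h1,
        isOccurrence_pattern3412_iff.2 ⟨hz, hwy.2, h2⟩⟩
    · left
      exact ⟨orderEmbedding3 hw hxy.1, isOccurrence_pattern321_iff.2 ⟨hxy.2, h2⟩⟩

section

variable {π : Equiv.Perm (Fin n)} {f f' : Fin 3 ↪o Fin n} {g g' : Fin 4 ↪o Fin n}

theorem adj_of_pattern321 (h : IsOccurrence pattern321 π f) :
    (inversionGraph π).Adj (f 0) (f 1) ∧ (inversionGraph π).Adj (f 1) (f 2) ∧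
      (inversionGraph π).Adj (f 2) (f 0) := by
  obtain ⟨h1, h2⟩ := isOccurrence_pattern321_iff.1 h
  exact ⟨Or.inl ⟨f.strictMono (by decide), h2⟩, Or.inl ⟨f.strictMono (by decide), h1⟩,
    Or.inr ⟨f.strictMono (by decide), h1.trans h2⟩⟩

theorem adj_of_pattern3412 (h : IsOccurrence pattern3412 π g) :
    (inversionGraph π).Adj (g 0) (g 2) ∧ (inversionGraph π).Adj (g 2) (g 1) ∧
      (inversionGraph π).Adj (g 1) (g 3) ∧ (inversionGraph π).Adj (g 3) (g 0) := by
  obtain ⟨h1, h2, h3⟩ := isOccurrence_pattern3412_iff.1 h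
  exact ⟨Or.inl ⟨g.strictMono (by decide), h1.trans h2⟩,
    Or.inr ⟨g.strictMono (by decide), (h1.trans h2).trans h3⟩,
    Or.inl ⟨g.strictMono (by decide), h2.trans h3⟩, Or.inr ⟨g.strictMono (by decide), h2⟩⟩

theorem mem_B_two_iff (hn : 0 < n) :
    π ∈ B n 2 ↔ IsUnicyclic (inversionGraph π) ∧ ∃ f, IsOccurrence pattern321 π f := by
  rw [B, Set.mem_ofPred_eq, cnat_eq_nbcNumber π hn]
  constructor
  · intro h
    have hU := isUnicyclic_of_nbcNumber h.ge (by omega)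
    refine ⟨hU, (exists_pattern hU).resolve_right ?_⟩
    rintro ⟨g, hg⟩
    obtain ⟨h1, h2, h3, h4⟩ := adj_of_pattern3412 hg
    have := hU.nbcNumber_of_square h1 h2 h3 h4 (g.injective.ne (by decide))
      (g.injective.ne (by decide))
    omega
  · rintro ⟨hU, f, hf⟩
    obtain ⟨h1, h2, h3⟩ := adj_of_pattern321 hf
    exact hU.nbcNumber_of_triangle h1 h2 h3

theorem mem_B_three_iff (hn : 0 < n) :
    π ∈ B n 3 ↔ IsUnicyclic (inversionGraph π) ∧ ∃ g, IsOccurrence pattern3412 π g := by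
  rw [B, Set.mem_ofPred_eq, cnat_eq_nbcNumber π hn]
  constructor
  · intro h
    have hU := isUnicyclic_of_nbcNumber (by omega) h.le
    refine ⟨hU, (exists_pattern hU).resolve_left ?_⟩
    rintro ⟨f, hf⟩
    obtain ⟨h1, h2, h3⟩ := adj_of_pattern321 hf
    have := hU.nbcNumber_of_triangle h1 h2 h3
    omega
  · rintro ⟨hU, g, hg⟩
    obtain ⟨h1, h2, h3, h4⟩ := adj_of_pattern3412 hg
    exact hU.nbcNumber_of_square h1 h2 h3 h4 (g.injective.ne (by decide))
      (g.injective.ne (by decide))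

/-- Every occurrence is a triangle whose edges are exactly the non-bridges, so its set of positions
is determined, and with it the order embedding. -/
theorem IsUnicyclic.pattern321_unique (hU : IsUnicyclic (inversionGraph π))
    (h : IsOccurrence pattern321 π f) : IsUniqueOccurrence pattern321 π f := by
  refine ⟨h, fun f' h' => ?_⟩
  obtain ⟨h1, h2, h3⟩ := adj_of_pattern321 h
  obtain ⟨h1', h2', h3'⟩ := adj_of_pattern321 h'
  have heq := (hU.triangle h1' h2' h3').trans (hU.triangle h1 h2 h3).symm
  have hmem : ∀ (f : Fin 3 ↪o Fin n) x, x ∈ Set.range f ↔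
      ∃ e ∈ ({s(f 0, f 1), s(f 1, f 2), s(f 2, f 0)} : Finset (Sym2 (Fin n))), x ∈ e := by
    intro f x
    simp only [Set.mem_range, Fin.exists_fin_succ, mem_insert, mem_singleton, exists_eq_or_imp,
      exists_eq_left, Sym2.mem_iff]
    simp
    grind
  rw [← OrderEmbedding.range_inj]
  ext x
  rw [hmem, hmem, heq]

theorem IsUnicyclic.pattern3412_unique (hU : IsUnicyclic (inversionGraph π))
    (h : IsOccurrence pattern3412 π g) : IsUniqueOccurrence pattern3412 π g := by
  refine ⟨h, fun g' h' => ?_⟩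
  obtain ⟨h1, h2, h3, h4⟩ := adj_of_pattern3412 h
  obtain ⟨h1', h2', h3', h4'⟩ := adj_of_pattern3412 h'
  have heq := (hU.square h1' h2' h3' h4' (g'.injective.ne (by decide))
    (g'.injective.ne (by decide))).trans (hU.square h1 h2 h3 h4 (g.injective.ne (by decide))
    (g.injective.ne (by decide))).symm
  have hmem : ∀ (f : Fin 4 ↪o Fin n) x, x ∈ Set.range f ↔
      ∃ e ∈ ({s(f 0, f 2), s(f 2, f 1), s(f 1, f 3), s(f 3, f 0)} : Finset (Sym2 (Fin n))),
        x ∈ e := by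
    intro f x
    simp only [Set.mem_range, Fin.exists_fin_succ, mem_insert, mem_singleton, exists_eq_or_imp,
      exists_eq_left, Sym2.mem_iff]
    simp
    grind
  rw [← OrderEmbedding.range_inj]
  ext x
  rw [hmem, hmem, heq]

theorem eq_of_forall_lt_iff (e : Equiv.Perm (Fin n)) {a b : Fin n} (h : ∀ x, x < a ↔ e x < b) :
    a = b := by
  have h1 : #(Iio a) = #(Iio b) := card_equiv e (by simpa using h)
  rw [Fin.card_Iio, Fin.card_Iio] at h1
  exact Fin.ext h1

/-- A letter forming an inversion with the middle letter could replace an outer letter of the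
occurrence. -/
theorem IsUniqueOccurrence.lt_iff (h : IsUniqueOccurrence pattern321 π f) {x : Fin n}
    (hx : x ∉ Set.range f) : x < f 1 ↔ π x < π (f 1) := by
  obtain ⟨h1, h2⟩ := isOccurrence_pattern321_iff.1 h.1
  have hne : ∀ i, x ≠ f i := fun i hi => hx ⟨i, hi.symm⟩
  have h12 : f 1 < f 2 := f.strictMono (by decide)
  have h01 : f 0 < f 1 := f.strictMono (by decide)
  constructor
  · intro hlt
    by_contra hge
    have hgt : π (f 1) < π x := lt_of_le_of_ne (not_lt.1 hge) (π.injective.ne (hne 1).symm)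
    have := h.2 (orderEmbedding3 hlt h12) (isOccurrence_pattern321_iff.2 ⟨h1, hgt⟩)
    exact hne 0 (congrArg (fun g => g 0) this)
  · intro hlt
    by_contra hge
    have hgt : f 1 < x := lt_of_le_of_ne (not_lt.1 hge) (hne 1).symm
    have := h.2 (orderEmbedding3 h01 hgt) (isOccurrence_pattern321_iff.2 ⟨hlt, h2⟩)
    exact hne 2 (congrArg (fun g => g 2) this)

theorem IsUniqueOccurrence.apply_middle (h : IsUniqueOccurrence pattern321 π f) :
    π (f 1) = f 1 := by
  obtain ⟨h1, h2⟩ := isOccurrence_pattern321_iff.1 h.1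
  have h12 : f 1 < f 2 := f.strictMono (by decide)
  have h01 : f 0 < f 1 := f.strictMono (by decide)
  -- After swapping the two outer letters, exactly the positions before `f 1` carry letters below `π
  -- (f 1)`; counting them gives the claim.
  refine (eq_of_forall_lt_iff ((Equiv.swap (f 0) (f 2)).trans π) fun x => ?_).symm
  rw [Equiv.trans_apply]
  by_cases hx : x ∈ Set.range f
  · obtain ⟨i, rfl⟩ := hx
    fin_cases i
    · simp [h1, h01]
    · simp [Equiv.swap_apply_of_ne_of_ne h01.ne' h12.ne]
    · simp [h2.le]
  · rw [Equiv.swap_apply_of_ne_of_ne (fun h => hx ⟨0, h.symm⟩) (fun h => hx ⟨2, h.symm⟩)]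
    exact h.lt_iff hx

/-- The letters outside the unique occurrence of 3412 in a permutation with a unicyclic inversion
graph lie to the left of and below the occurrence, or to the right of and above it, when seen from
its middle. -/
theorem IsUnicyclic.outside_pattern3412 (hU : IsUnicyclic (inversionGraph π))
    (h : IsOccurrence pattern3412 π g) {x : Fin n} (hx : x ∉ Set.range g) :
    (x < g 1 ∧ π x < π (g 3)) ∨ (g 2 < x ∧ π (g 0) < π x) := by
  obtain ⟨h1, h2, h3⟩ := isOccurrence_pattern3412_iff.1 h
  obtain ⟨a1, a2, a3, a4⟩ := adj_of_pattern3412 h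
  have g01 : g 0 < g 1 := g.strictMono (by decide)
  have g12 : g 1 < g 2 := g.strictMono (by decide)
  have g23 : g 2 < g 3 := g.strictMono (by decide)
  have hne : ∀ i, x ≠ g i := fun i hi => hx ⟨i, hi.symm⟩
  have hne' : ∀ i, π x ≠ π (g i) := fun i => π.injective.ne (hne i)
  -- An outside letter cannot form inversions with both positions of any of the pairs `{0, 1}`, `{2,
  -- 3}`, `{1, 2}`, `{0, 3}` of the occurrence; order comparisons do the rest.
  have e1 := hU.not_adj_of_square_diagonal (x := x) a1 a2 a3 a4 g01.ne g23.ne (hne 2) (hne 3)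
  have e2 := hU.not_adj_of_square_diagonal (x := x) a2 a3 a4 a1 g23.ne g01.ne' (hne 1) (hne 0)
  have e3 := hU.not_adj_of_square_side (x := x) a2 a3 a4 a1 g23.ne g01.ne'
  have e4 := hU.not_adj_of_square_side (x := x) a4 a1 a2 a3 g23.ne' g01.ne
  have n0 := hne 0
  have n1 := hne 1
  have n2 := hne 2
  have n3 := hne 3
  have m0 := hne' 0
  have m1 := hne' 1
  have m2 := hne' 2
  have m3 := hne' 3
  simp only [inversionGraph_adj] at e1 e2 e3 e4
  grind

end

end Patterns

/-! ### Counting inversions, and connectedness by cuts -/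

section Inversions

open Finset SimpleGraph

variable {n : ℕ}

/-- The indicator function of the inversions of `π`. -/
def inversionIndicator (π : Equiv.Perm (Fin n)) (x y : Fin n) : ℕ :=
  if (x < y ∧ π y < π x) ∨ (y < x ∧ π x < π y) then 1 else 0

theorem inversionIndicator_comm (π : Equiv.Perm (Fin n)) (x y : Fin n) :
    inversionIndicator π x y = inversionIndicator π y x := by
  simp only [inversionIndicator]
  exact if_congr or_comm rfl rfl

theorem sum_inversionIndicator (π : Equiv.Perm (Fin n)) :
    ∑ x, ∑ y, inversionIndicator π x y = 2 * #(edges (inversionGraph π)) := by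
  classical
  rw [edges_eq_edgeFinset, ← sum_degrees_eq_twice_card_edges]
  refine sum_congr rfl fun x _ => ?_
  rw [← card_neighborFinset_eq_degree, neighborFinset_eq_filter, card_filter]
  refine sum_congr rfl fun y _ => ?_
  rw [inversionIndicator]
  exact if_congr Iff.rfl rfl rfl

theorem sum_inversionIndicator_pattern {k : ℕ} {τ : Equiv.Perm (Fin k)} {π : Equiv.Perm (Fin n)}
    {g : Fin k ↪o Fin n} (h : IsOccurrence τ π g) :
    ∑ a, ∑ b, inversionIndicator π (g a) (g b) = ∑ a, ∑ b, inversionIndicator τ a b := by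
  refine sum_congr rfl fun a _ => sum_congr rfl fun b _ => ?_
  simp only [inversionIndicator, h a b, h b a, g.lt_iff_lt]

/-- If two permutations agree outside the positions `g`, and if every other position has equally
many inversions with these positions in both of them, then the numbers of their inversions differ
as those among the positions `g` do. -/
theorem sum_inversionIndicator_of_agree {k : ℕ} {σ τ : Equiv.Perm (Fin n)} (g : Fin k ↪o Fin n)
    (hagree : ∀ x, x ∉ Set.range g → σ x = τ x)
    (hsum : ∀ x, x ∉ Set.range g →
      ∑ a, inversionIndicator σ x (g a) = ∑ a, inversionIndicator τ x (g a)) :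
    ∑ x, ∑ y, inversionIndicator σ x y + ∑ a, ∑ b, inversionIndicator τ (g a) (g b) =
      ∑ x, ∑ y, inversionIndicator τ x y + ∑ a, ∑ b, inversionIndicator σ (g a) (g b) := by
  have hsplit : ∀ F : Fin n → ℕ, ∑ x, F x =
      ∑ a, F (g a) + ∑ x ∈ (univ.map g.toEmbedding)ᶜ, F x := by
    intro F
    rw [← sum_add_sum_compl (univ.map g.toEmbedding), sum_map]
    rfl
  have hmem : ∀ x ∈ (univ.map g.toEmbedding)ᶜ, x ∉ Set.range g := by
    intro x hx
    simpa using hx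
  have hdecomp : ∀ σ : Equiv.Perm (Fin n), ∑ x, ∑ y, inversionIndicator σ x y =
      ∑ a, ∑ b, inversionIndicator σ (g a) (g b) +
        2 * ∑ x ∈ (univ.map g.toEmbedding)ᶜ, ∑ a, inversionIndicator σ x (g a) +
        ∑ x ∈ (univ.map g.toEmbedding)ᶜ, ∑ y ∈ (univ.map g.toEmbedding)ᶜ,
          inversionIndicator σ x y := by
    intro σ
    rw [hsplit]
    have h1 : ∀ x, ∑ y, inversionIndicator σ x y = ∑ a, inversionIndicator σ x (g a) +
        ∑ y ∈ (univ.map g.toEmbedding)ᶜ, inversionIndicator σ x y := fun x => hsplit _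
    have h2 : ∑ a, ∑ y ∈ (univ.map g.toEmbedding)ᶜ, inversionIndicator σ (g a) y =
        ∑ x ∈ (univ.map g.toEmbedding)ᶜ, ∑ a, inversionIndicator σ x (g a) := by
      rw [sum_comm]
      exact sum_congr rfl fun x _ => sum_congr rfl fun a _ => inversionIndicator_comm σ _ _
    rw [sum_congr rfl fun a _ => h1 (g a), sum_congr rfl fun x _ => h1 x, sum_add_distrib,
      sum_add_distrib, h2]
    ring
  rw [hdecomp σ, hdecomp τ, sum_congr rfl fun x hx => hsum x (hmem x hx)]
  have : ∑ x ∈ (univ.map g.toEmbedding)ᶜ, ∑ y ∈ (univ.map g.toEmbedding)ᶜ,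
      inversionIndicator σ x y = ∑ x ∈ (univ.map g.toEmbedding)ᶜ,
        ∑ y ∈ (univ.map g.toEmbedding)ᶜ, inversionIndicator τ x y := by
    refine sum_congr rfl fun x hx => sum_congr rfl fun y hy => ?_
    simp only [inversionIndicator, hagree x (hmem x hx), hagree y (hmem y hy)]
  rw [this]
  ring

/-- The first `m` letters of `π` are the letters that are less than `m`. -/
def IsCut (π : Equiv.Perm (Fin n)) (m : ℕ) : Prop := ∀ x : Fin n, (x : ℕ) < m ↔ (π x : ℕ) < m

theorem isCut_of_forall_lt {π : Equiv.Perm (Fin n)} {m : ℕ}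
    (h : ∀ x : Fin n, (x : ℕ) < m → (π x : ℕ) < m) : IsCut π m := by
  refine fun x => ⟨h x, fun hx => ?_⟩
  have hsub : (univ.filter (fun x : Fin n => (x : ℕ) < m)).map π.toEmbedding ⊆
      univ.filter (fun x : Fin n => (x : ℕ) < m) := by
    intro y hy
    simp only [mem_map, mem_filter, mem_univ, true_and, Equiv.coe_toEmbedding] at hy ⊢
    obtain ⟨z, hz, rfl⟩ := hy
    exact h z hz
  have heq := eq_of_subset_of_card_le hsub (by rw [card_map])
  have hmem : π x ∈ univ.filter (fun x : Fin n => (x : ℕ) < m) := by simpa using hx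
  rw [← heq] at hmem
  simpa using hmem

theorem isCut_of_forall_le {π : Equiv.Perm (Fin n)} {m : ℕ}
    (h : ∀ x : Fin n, m ≤ (x : ℕ) → m ≤ (π x : ℕ)) : IsCut π m := by
  have : IsCut π.symm m := isCut_of_forall_lt fun x hx => by
    by_contra hge
    have := h _ (not_lt.1 hge)
    rw [Equiv.apply_symm_apply] at this
    omega
  intro x
  simpa using (this (π x)).symm

/-- No inversion crosses a cut. Conversely, if the graph is disconnected, the component of 0
precedes all other vertices in position and in value, and its end is a cut. -/
theorem connected_inversionGraph_iff {π : Equiv.Perm (Fin n)} (hn : 0 < n) :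
    (inversionGraph π).Connected ↔ ∀ m, 0 < m → m < n → ¬ IsCut π m := by
  constructor
  · intro hc m hm hmn hcut
    have : (⟨m, hmn⟩ : Fin n) ∈ {x : Fin n | (x : ℕ) < m} := by
      refine mem_of_reachable (fun x y hxy hx => ?_) (hc.preconnected ⟨0, hn⟩ _) hm
      by_contra hy
      have h1 := (hcut x).1 hx
      have h2 := mt (hcut y).2 hy
      have h3 : (x : ℕ) < m := hx
      have h4 : ¬ (y : ℕ) < m := hy
      rcases hxy with ⟨_, h⟩ | ⟨h, _⟩
      · rw [Fin.lt_def] at h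
        omega
      · rw [Fin.lt_def] at h
        omega
    exact lt_irrefl m this
  · intro h
    classical
    rw [connected_iff_exists_forall_reachable]
    refine ⟨⟨0, hn⟩, ?_⟩
    by_contra! hne
    obtain ⟨z₀, hz₀, hmin⟩ := exists_min_image
      (univ.filter (fun w => ¬ (inversionGraph π).Reachable ⟨0, hn⟩ w)) id
      (by obtain ⟨w, hw⟩ := hne; exact ⟨w, by simpa using hw⟩)
    rw [mem_filter] at hz₀
    -- A walk from 0 that never forms an inversion with `z` stays on the lower left of `z`: an edge
    -- leading past `z` would have an end that forms an inversion with `z`.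
    have hsep : ∀ x z, (inversionGraph π).Reachable ⟨0, hn⟩ x →
        ¬ (inversionGraph π).Reachable ⟨0, hn⟩ z → x < z ∧ π x < π z := by
      intro x z hx hz
      have hnadj : ∀ b, (inversionGraph π).Reachable ⟨0, hn⟩ b →
          b ≠ z ∧ ¬ (inversionGraph π).Adj b z := by
        intro b hb
        refine ⟨?_, fun hbz => hz (hb.trans hbz.reachable)⟩
        rintro rfl
        exact hz hb
      have : x ∈ {x | (inversionGraph π).Reachable ⟨0, hn⟩ x ∧ x < z ∧ π x < π z} := by
        refine mem_of_reachable (fun a b hab ha => ?_) hx ?_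
        · obtain ⟨h1, h2, h3⟩ := ha
          have hb := h1.trans hab.reachable
          obtain ⟨h4, h5⟩ := hnadj b hb
          have h6 := π.injective.ne h4
          rw [inversionGraph_adj] at h5 hab
          exact ⟨hb, by grind⟩
        · obtain ⟨h4, h5⟩ := hnadj ⟨0, hn⟩ (Reachable.refl _)
          have h6 := π.injective.ne h4
          have h7 : (⟨0, hn⟩ : Fin n) < z := lt_of_le_of_ne (Nat.zero_le _) h4
          rw [inversionGraph_adj] at h5
          exact ⟨Reachable.refl _, h7, by grind⟩
      exact this.2
    have hK : ∀ x : Fin n, x < z₀ → (inversionGraph π).Reachable ⟨0, hn⟩ x := by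
      intro x hx
      by_contra hxr
      exact absurd (hmin x (by simpa using hxr)) (not_le.2 hx)
    refine h z₀ ?_ z₀.2 (isCut_of_forall_lt fun x hx => ?_)
    · exact (hsep ⟨0, hn⟩ z₀ (Reachable.refl _) hz₀.2).1
    -- All letters up to `π x` stand before `z₀`, so there are at most `z₀` of them.
    · have hsub : Iic (π x) ⊆ (Iio z₀).map π.toEmbedding := by
        intro v hv
        rw [mem_Iic] at hv
        refine mem_map.2 ⟨π.symm v, ?_, by simp⟩
        rw [mem_Iio]
        by_contra hge
        have hnr : ¬ (inversionGraph π).Reachable ⟨0, hn⟩ (π.symm v) := fun hr =>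
          hge (hsep _ _ hr hz₀.2).1
        have := (hsep x _ (hK x hx) hnr).2
        rw [Equiv.apply_symm_apply] at this
        exact absurd hv (not_le.2 this)
      have := card_le_card hsub
      rw [card_map, Fin.card_Iic, Fin.card_Iio] at this
      omega

end Inversions

/-! ### Inserting the fixed point and switching 4231 to 3412 -/

section Pivot

open Finset SimpleGraph

variable {n : ℕ}

/-- `f` is an occurrence of 321 whose middle letter is a fixed point and forms no inversion with the
letters outside the occurrence. -/
structure IsPivot (π : Equiv.Perm (Fin n)) (f : Fin 3 ↪o Fin n) : Prop where
  occurrence : IsOccurrence pattern321 π f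
  fixed : π (f 1) = f 1
  outside : ∀ x, x ∉ Set.range f → (x < f 1 ↔ π x < f 1)

theorem IsUniqueOccurrence.isPivot {π : Equiv.Perm (Fin n)} {f : Fin 3 ↪o Fin n}
    (h : IsUniqueOccurrence pattern321 π f) : IsPivot π f :=
  ⟨h.1, h.apply_middle, fun x hx => by rw [h.lt_iff hx, h.apply_middle]⟩

/-- The permutation obtained from `π` by inserting a fixed point after the middle letter of the
occurrence `f` of 321 and changing the resulting 4231 to 3412. -/
noncomputable def splitSwitch (π : Equiv.Perm (Fin n)) (f : Fin 3 ↪o Fin n) :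
    Equiv.Perm (Fin (n + 1)) :=
  changePattern pattern4231 pattern3412 (splitMiddle f) (insertFixedPoint (f 1).succ π)

theorem splitMiddle_zero (f : Fin 3 ↪o Fin n) : splitMiddle f 0 = (f 0).castSucc := rfl
theorem splitMiddle_one (f : Fin 3 ↪o Fin n) : splitMiddle f 1 = (f 1).castSucc := rfl
theorem splitMiddle_two (f : Fin 3 ↪o Fin n) : splitMiddle f 2 = (f 1).succ := rfl
theorem splitMiddle_three (f : Fin 3 ↪o Fin n) : splitMiddle f 3 = (f 2).succ := rfl

theorem exists_of_notMem_range_splitMiddle {f : Fin 3 ↪o Fin n} {y : Fin (n + 1)}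
    (hy : y ∉ Set.range (splitMiddle f)) :
    ∃ x, x ∉ Set.range f ∧ ((x < f 1 ∧ y = x.castSucc) ∨ (f 1 < x ∧ y = x.succ)) := by
  have hne : ∀ i, y ≠ splitMiddle f i := fun i hi => hy ⟨i, hi.symm⟩
  obtain ⟨x, rfl⟩ := (Fin.eq_self_or_eq_succAbove (f 1).succ y).resolve_left (hne 2)
  have h01 : f 0 < f 1 := f.strictMono (by decide)
  have h12 : f 1 < f 2 := f.strictMono (by decide)
  have hx : x ∉ Set.range f := by
    rintro ⟨i, rfl⟩
    fin_cases i
    · exact hne 0 (Fin.succAbove_succ_of_le _ _ h01.le)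
    · exact hne 1 (Fin.succAbove_succ_of_le _ _ le_rfl)
    · exact hne 3 (Fin.succAbove_succ_of_lt _ _ h12)
  refine ⟨x, hx, ?_⟩
  rcases lt_trichotomy x (f 1) with h | h | h
  · exact Or.inl ⟨h, Fin.succAbove_succ_of_le _ _ h.le⟩
  · exact absurd ⟨1, h.symm⟩ hx
  · exact Or.inr ⟨h, Fin.succAbove_succ_of_lt _ _ h⟩

theorem castSucc_notMem_range_splitMiddle {f : Fin 3 ↪o Fin n} {x : Fin n} (hx : x ∉ Set.range f)
    (hlt : x < f 1) : x.castSucc ∉ Set.range (splitMiddle f) := by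
  rintro ⟨i, hi⟩
  have h12 : f 1 < f 2 := f.strictMono (by decide)
  fin_cases i
  · exact hx ⟨0, Fin.castSucc_injective _ hi⟩
  · exact hx ⟨1, Fin.castSucc_injective _ hi⟩
  · have := congrArg Fin.val (show (f 1).succ = x.castSucc from hi)
    simp only [Fin.val_succ, Fin.val_castSucc] at this
    omega
  · have := congrArg Fin.val (show (f 2).succ = x.castSucc from hi)
    simp only [Fin.val_succ, Fin.val_castSucc] at this
    omega

theorem succ_notMem_range_splitMiddle {f : Fin 3 ↪o Fin n} {x : Fin n} (hx : x ∉ Set.range f)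
    (hlt : f 1 < x) : x.succ ∉ Set.range (splitMiddle f) := by
  rintro ⟨i, hi⟩
  have h01 : f 0 < f 1 := f.strictMono (by decide)
  fin_cases i
  · have := congrArg Fin.val (show (f 0).castSucc = x.succ from hi)
    simp only [Fin.val_succ, Fin.val_castSucc] at this
    omega
  · have := congrArg Fin.val (show (f 1).castSucc = x.succ from hi)
    simp only [Fin.val_succ, Fin.val_castSucc] at this
    omega
  · exact hx ⟨1, Fin.succ_injective _ hi⟩
  · exact hx ⟨2, Fin.succ_injective _ hi⟩

section

variable {π : Equiv.Perm (Fin n)} {m x : Fin n}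

theorem insertFixedPoint_le_le (h1 : x ≤ m) (h2 : π x ≤ m) :
    insertFixedPoint m.succ π x.castSucc = (π x).castSucc := by
  rw [← Fin.succAbove_succ_of_le _ _ h1, insertFixedPoint_succAbove,
    Fin.succAbove_succ_of_le _ _ h2]

theorem insertFixedPoint_le_lt (h1 : x ≤ m) (h2 : m < π x) :
    insertFixedPoint m.succ π x.castSucc = (π x).succ := by
  rw [← Fin.succAbove_succ_of_le _ _ h1, insertFixedPoint_succAbove,
    Fin.succAbove_succ_of_lt _ _ h2]

theorem insertFixedPoint_lt_le (h1 : m < x) (h2 : π x ≤ m) :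
    insertFixedPoint m.succ π x.succ = (π x).castSucc := by
  rw [← Fin.succAbove_succ_of_lt _ _ h1, insertFixedPoint_succAbove,
    Fin.succAbove_succ_of_le _ _ h2]

theorem insertFixedPoint_lt_lt (h1 : m < x) (h2 : m < π x) :
    insertFixedPoint m.succ π x.succ = (π x).succ := by
  rw [← Fin.succAbove_succ_of_lt _ _ h1, insertFixedPoint_succAbove,
    Fin.succAbove_succ_of_lt _ _ h2]

end

namespace IsPivot

variable {π : Equiv.Perm (Fin n)} {f : Fin 3 ↪o Fin n}

theorem lt_apply_zero (h : IsPivot π f) : f 1 < π (f 0) :=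
  h.fixed ▸ (isOccurrence_pattern321_iff.1 h.occurrence).2

theorem apply_two_lt (h : IsPivot π f) : π (f 2) < f 1 := by
  have := (isOccurrence_pattern321_iff.1 h.occurrence).1
  rwa [h.fixed] at this

theorem insert_zero (h : IsPivot π f) :
    insertFixedPoint (f 1).succ π (f 0).castSucc = (π (f 0)).succ :=
  insertFixedPoint_le_lt (f.strictMono (by decide : (0 : Fin 3) < 1)).le h.lt_apply_zero

theorem insert_one (h : IsPivot π f) :
    insertFixedPoint (f 1).succ π (f 1).castSucc = (f 1).castSucc := by
  rw [insertFixedPoint_le_le le_rfl h.fixed.le, h.fixed]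

theorem insert_two : insertFixedPoint (f 1).succ π (f 1).succ = (f 1).succ :=
  insertFixedPoint_self _ _

theorem insert_three (h : IsPivot π f) :
    insertFixedPoint (f 1).succ π (f 2).succ = (π (f 2)).castSucc :=
  insertFixedPoint_lt_le (f.strictMono (by decide : (1 : Fin 3) < 2)) h.apply_two_lt.le

theorem lt_of_outside (h : IsPivot π f) {x : Fin n} (hx : x ∉ Set.range f) (hlt : f 1 < x) :
    f 1 < π x := by
  refine lt_of_le_of_ne (not_lt.1 fun h' => hlt.asymm ((h.outside x hx).2 h')) ?_
  intro h'
  exact hx ⟨1, π.injective (h.fixed.trans h')⟩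

theorem insert_of_lt (h : IsPivot π f) {x : Fin n} (hx : x ∉ Set.range f) (hlt : x < f 1) :
    insertFixedPoint (f 1).succ π x.castSucc = (π x).castSucc :=
  insertFixedPoint_le_le hlt.le ((h.outside x hx).1 hlt).le

theorem insert_of_gt (h : IsPivot π f) {x : Fin n} (hx : x ∉ Set.range f) (hlt : f 1 < x) :
    insertFixedPoint (f 1).succ π x.succ = (π x).succ :=
  insertFixedPoint_lt_lt hlt (h.lt_of_outside hx hlt)

theorem pattern4231 (h : IsPivot π f) :
    IsOccurrence pattern4231 (insertFixedPoint (f 1).succ π) (splitMiddle f) := by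
  rw [isOccurrence_pattern4231_iff, splitMiddle_zero, splitMiddle_one, splitMiddle_two,
    splitMiddle_three, h.insert_zero, h.insert_one, insert_two, h.insert_three]
  exact ⟨Fin.castSucc_lt_castSucc_iff.2 h.apply_two_lt, Fin.castSucc_lt_succ,
    Fin.succ_lt_succ_iff.2 h.lt_apply_zero⟩

theorem splitSwitch_zero : splitSwitch π f (f 0).castSucc = (f 1).succ :=
  (changePattern_apply _ _ (splitMiddle f) _ 0).trans insert_two

theorem splitSwitch_one (h : IsPivot π f) : splitSwitch π f (f 1).castSucc = (π (f 0)).succ :=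
  (changePattern_apply _ _ (splitMiddle f) _ 1).trans h.insert_zero

theorem splitSwitch_two (h : IsPivot π f) : splitSwitch π f (f 1).succ = (π (f 2)).castSucc :=
  (changePattern_apply _ _ (splitMiddle f) _ 2).trans h.insert_three

theorem splitSwitch_three (h : IsPivot π f) : splitSwitch π f (f 2).succ = (f 1).castSucc :=
  (changePattern_apply _ _ (splitMiddle f) _ 3).trans h.insert_one

theorem splitSwitch_of_notMem {l : Fin (n + 1)} (hl : l ∉ Set.range (splitMiddle f)) :
    splitSwitch π f l = insertFixedPoint (f 1).succ π l :=
  changePattern_apply_of_notMem _ _ _ _ _ hl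

theorem splitSwitch_of_lt (h : IsPivot π f) {x : Fin n} (hx : x ∉ Set.range f) (hlt : x < f 1) :
    splitSwitch π f x.castSucc = (π x).castSucc := by
  rw [splitSwitch_of_notMem (castSucc_notMem_range_splitMiddle hx hlt), h.insert_of_lt hx hlt]

theorem splitSwitch_of_gt (h : IsPivot π f) {x : Fin n} (hx : x ∉ Set.range f) (hlt : f 1 < x) :
    splitSwitch π f x.succ = (π x).succ := by
  rw [splitSwitch_of_notMem (succ_notMem_range_splitMiddle hx hlt), h.insert_of_gt hx hlt]

theorem pattern3412 (h : IsPivot π f) :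
    IsOccurrence pattern3412 (splitSwitch π f) (splitMiddle f) := by
  rw [isOccurrence_pattern3412_iff, splitMiddle_zero, splitMiddle_one, splitMiddle_two,
    splitMiddle_three, splitSwitch_zero, h.splitSwitch_one, h.splitSwitch_two,
    h.splitSwitch_three]
  exact ⟨Fin.castSucc_lt_castSucc_iff.2 h.apply_two_lt, Fin.castSucc_lt_succ,
    Fin.succ_lt_succ_iff.2 h.lt_apply_zero⟩

/-- The new fixed point forms inversions only with the two outer letters of the 321; each inversion
is counted as two ordered pairs. -/
theorem sum_inversionIndicator_insert (h : IsPivot π f) :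
    ∑ x, ∑ y, inversionIndicator (insertFixedPoint (f 1).succ π) x y =
      ∑ x, ∑ y, inversionIndicator π x y + 4 := by
  set p := (f 1).succ
  set τ := insertFixedPoint p π
  have h01 : f 0 < f 1 := f.strictMono (by decide)
  have h12 : f 1 < f 2 := f.strictMono (by decide)
  have hτ : ∀ x y, inversionIndicator τ (p.succAbove x) (p.succAbove y) =
      inversionIndicator π x y := by
    intro x y
    simp only [inversionIndicator, τ, insertFixedPoint_succAbove, Fin.succAbove_lt_succAbove_iff]
  have hp : ∀ x, inversionIndicator τ p (p.succAbove x) =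
      (if x = f 0 then 1 else 0) + (if x = f 2 then 1 else 0) := by
    intro x
    have hval : ∀ z : Fin n, (p.succAbove z : ℕ) = if z ≤ f 1 then (z : ℕ) else z + 1 := by
      intro z
      split_ifs with hz
      · rw [Fin.succAbove_succ_of_le _ _ hz]; rfl
      · rw [Fin.succAbove_succ_of_lt _ _ (not_le.1 hz)]; rfl
    have hpv : (p : ℕ) = f 1 + 1 := rfl
    have hiff : (p < p.succAbove x ∧ τ (p.succAbove x) < τ p) ∨
        (p.succAbove x < p ∧ τ p < τ (p.succAbove x)) ↔ x = f 0 ∨ x = f 2 := by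
      simp only [τ, insertFixedPoint_succAbove, insertFixedPoint_self]
      rw [Fin.lt_def, Fin.lt_def, Fin.lt_def, Fin.lt_def, hval, hval, hpv]
      have e0 := h.lt_apply_zero
      have e2 := h.apply_two_lt
      by_cases hx : x ∈ Set.range f
      · obtain ⟨i, rfl⟩ := hx
        fin_cases i
        · simp only [Fin.zero_eta, true_or, iff_true]
          rw [if_pos h01.le, if_neg e0.not_ge]
          omega
        · simp only [Fin.mk_one, h.fixed, le_refl, if_true, EmbeddingLike.apply_eq_iff_eq]
          simp
        · simp only [Fin.reduceFinMk, or_true, iff_true]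
          rw [if_pos e2.le, if_neg h12.not_ge]
          omega
      · have hx0 : x ≠ f 0 := fun h' => hx ⟨0, h'.symm⟩
        have hx1 : x ≠ f 1 := fun h' => hx ⟨1, h'.symm⟩
        have hx2 : x ≠ f 2 := fun h' => hx ⟨2, h'.symm⟩
        simp only [hx0, hx2, or_self, iff_false]
        rcases lt_or_gt_of_ne hx1 with hlt | hlt
        · have := (h.outside x hx).1 hlt
          rw [if_pos hlt.le, if_pos this.le]
          omega
        · have := h.lt_of_outside hx hlt
          rw [if_neg hlt.not_ge, if_neg this.not_ge]
          omega
    rw [inversionIndicator, if_congr hiff rfl rfl]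
    have hne : f 0 ≠ f 2 := f.injective.ne (by decide)
    by_cases h0 : x = f 0
    · simp [h0, hne]
    · simp [h0]
  have hsum : ∑ x, inversionIndicator τ p (p.succAbove x) = 2 := by
    rw [sum_congr rfl fun x _ => hp x, sum_add_distrib]
    simp
  have hself : inversionIndicator τ p p = 0 := by simp [inversionIndicator]
  rw [Fin.sum_univ_succAbove _ p]
  simp only [Fin.sum_univ_succAbove _ p, hτ, hself, sum_add_distrib]
  simp only [inversionIndicator_comm τ (p.succAbove _) p, hsum]
  ring

/-- The insertion adds two inversions, and the switch loses one: 4231 has five inversions and 3412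
has four. In ordered pairs these are 4, 10 and 8. -/
theorem sum_inversionIndicator_splitSwitch (h : IsPivot π f) :
    ∑ x, ∑ y, inversionIndicator (splitSwitch π f) x y =
      ∑ x, ∑ y, inversionIndicator π x y + 2 := by
  have hsame := sum_inversionIndicator_of_agree (σ := splitSwitch π f)
    (τ := insertFixedPoint (f 1).succ π) (splitMiddle f)
    (fun y hy => splitSwitch_of_notMem hy) (by
      intro y hy
      have h01 : f 0 < f 1 := f.strictMono (by decide)
      have h12 : f 1 < f 2 := f.strictMono (by decide)
      have e0 := h.lt_apply_zero
      have e2 := h.apply_two_lt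
      simp only [Fin.sum_univ_four, splitMiddle_zero, splitMiddle_one, splitMiddle_two,
        splitMiddle_three, inversionIndicator, splitSwitch_zero, h.splitSwitch_one,
        h.splitSwitch_two, h.splitSwitch_three, h.insert_zero, h.insert_one, insert_two,
        h.insert_three]
      obtain ⟨x, hx, ⟨hlt, rfl⟩ | ⟨hlt, rfl⟩⟩ := exists_of_notMem_range_splitMiddle hy
      · have e := (h.outside x hx).1 hlt
        rw [h.splitSwitch_of_lt hx hlt, h.insert_of_lt hx hlt]
        simp only [Fin.lt_def, Fin.val_succ, Fin.val_castSucc] at *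
        -- For an outside letter on the lower left, the switch only exchanges the contributions of
        -- the last two positions of the occurrence; on the upper right, those of the first two.
        have hc : ∀ {a b c d a' b' c' d' : ℕ}, a = a' → b = b' → c = d' → d = c' →
          a + b + c + d = a' + b' + c' + d' := by omega
        refine hc ?_ ?_ ?_ ?_ <;> exact if_congr (by omega) rfl rfl
      · have e := h.lt_of_outside hx hlt
        rw [h.splitSwitch_of_gt hx hlt, h.insert_of_gt hx hlt]
        simp only [Fin.lt_def, Fin.val_succ, Fin.val_castSucc] at *
        have hc : ∀ {a b c d a' b' c' d' : ℕ}, a = b' → b = a' → c = c' → d = d' →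
          a + b + c + d = a' + b' + c' + d' := by omega
        refine hc ?_ ?_ ?_ ?_ <;> exact if_congr (by omega) rfl rfl)
  rw [sum_inversionIndicator_pattern h.pattern4231, sum_inversionIndicator_pattern h.pattern3412,
    h.sum_inversionIndicator_insert,
    show ∑ a, ∑ b, inversionIndicator NonAmbiguousTrees.pattern4231 a b = 10 by decide,
    show ∑ a, ∑ b, inversionIndicator NonAmbiguousTrees.pattern3412 a b = 8 by decide] at hsame
  omega

theorem card_edges_splitSwitch (h : IsPivot π f) :
    #(edges (inversionGraph (splitSwitch π f))) = #(edges (inversionGraph π)) + 1 := by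
  have := h.sum_inversionIndicator_splitSwitch
  rw [sum_inversionIndicator, sum_inversionIndicator] at this
  omega

theorem isCut_splitSwitch_iff (h : IsPivot π f) {m : ℕ} (hm : m ≤ f 0) :
    IsCut (splitSwitch π f) m ↔ IsCut π m := by
  have h01 : f 0 < f 1 := f.strictMono (by decide)
  have hx : ∀ x : Fin n, (x : ℕ) < m → x ∉ Set.range f := by
    rintro x hx ⟨i, rfl⟩
    have : f 0 ≤ f i := f.monotone (Fin.zero_le i)
    rw [Fin.le_def] at this
    omega
  constructor
  · refine fun hc => isCut_of_forall_lt fun x hxm => ?_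
    have := (hc x.castSucc).1 hxm
    rwa [h.splitSwitch_of_lt (hx x hxm) (lt_trans (Fin.lt_def.2 (by omega)) h01)] at this
  · refine fun hc => isCut_of_forall_lt fun y hym => ?_
    have hyn : (y : ℕ) < n := by omega
    have hxm : ((⟨y, hyn⟩ : Fin n) : ℕ) < m := hym
    have := (hc ⟨y, hyn⟩).1 hxm
    rw [show y = Fin.castSucc ⟨y, hyn⟩ from rfl,
      h.splitSwitch_of_lt (hx _ hxm) (lt_trans (Fin.lt_def.2 (by omega)) h01)]
    exact this

theorem isCut_splitSwitch_add_one_iff (h : IsPivot π f) {m : ℕ} (hm : f 2 < m) :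
    IsCut (splitSwitch π f) (m + 1) ↔ IsCut π m := by
  have h12 : f 1 < f 2 := f.strictMono (by decide)
  have hx : ∀ x : Fin n, m ≤ (x : ℕ) → x ∉ Set.range f := by
    rintro x hx ⟨i, rfl⟩
    have : f i ≤ f 2 := f.monotone (Fin.le_last i)
    rw [Fin.le_def] at this
    omega
  constructor
  · refine fun hc => isCut_of_forall_le fun x hxm => ?_
    have := mt (hc x.succ).2 (by rw [Fin.val_succ]; omega)
    rw [h.splitSwitch_of_gt (hx x hxm) (lt_trans h12 (Fin.lt_def.2 (by omega))),
      Fin.val_succ] at this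
    omega
  · refine fun hc => isCut_of_forall_le fun y hym => ?_
    obtain ⟨x, rfl⟩ := Fin.exists_succ_eq.2 (show y ≠ 0 by rintro rfl; simp at hym)
    rw [Fin.val_succ] at hym
    have hxm : m ≤ (x : ℕ) := by omega
    have := mt (hc x).2 (by omega)
    rw [h.splitSwitch_of_gt (hx x hxm) (lt_trans h12 (Fin.lt_def.2 (by omega))),
      Fin.val_succ]
    omega

theorem not_isCut (h : IsPivot π f) {m : ℕ} (h0 : f 0 < m) (h2 : m ≤ f 2) : ¬ IsCut π m := by
  intro hc
  have e1 := (hc (f 0)).1 h0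
  have e2 := mt (hc (f 2)).2 (by omega)
  have e3 := h.lt_apply_zero
  have e4 := h.apply_two_lt
  rw [Fin.lt_def] at e3 e4
  omega

theorem not_isCut_splitSwitch (h : IsPivot π f) {m : ℕ} (h0 : f 0 < m) (h2 : m ≤ f 2 + 1) :
    ¬ IsCut (splitSwitch π f) m := by
  intro hc
  have e1 := (hc (f 0).castSucc).1 h0
  have e2 := mt (hc (f 2).succ).2 (by rw [Fin.val_succ]; omega)
  rw [splitSwitch_zero, Fin.val_succ] at e1
  rw [h.splitSwitch_three, Fin.val_castSucc] at e2
  omega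

/-- No cut passes through the occurrence in either permutation. Cuts before it are unchanged, and
cuts after it shift by one. -/
theorem connected_splitSwitch_iff (h : IsPivot π f) :
    (inversionGraph (splitSwitch π f)).Connected ↔ (inversionGraph π).Connected := by
  have hn : 0 < n := (f 0).pos
  rw [connected_inversionGraph_iff hn, connected_inversionGraph_iff n.succ_pos]
  constructor
  · intro hc m hm hmn
    rcases le_or_gt m (f 0) with h0 | h0
    · rw [← h.isCut_splitSwitch_iff h0]
      exact hc m hm (by omega)
    rcases le_or_gt m (f 2) with h2 | h2
    · exact h.not_isCut h0 h2
    · rw [← h.isCut_splitSwitch_add_one_iff h2]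
      exact hc (m + 1) (by omega) (by omega)
  · intro hc m hm hmn
    rcases le_or_gt m (f 0) with h0 | h0
    · rw [h.isCut_splitSwitch_iff h0]
      exact hc m hm (by omega)
    rcases le_or_gt m (f 2 + 1) with h2 | h2
    · exact h.not_isCut_splitSwitch h0 h2
    · obtain ⟨k, rfl⟩ := Nat.exists_eq_add_of_lt (show 0 < m by omega)
      rw [zero_add, h.isCut_splitSwitch_add_one_iff (by omega)]
      exact hc k (by omega) (by omega)

theorem isUnicyclic_splitSwitch_iff (h : IsPivot π f) :
    IsUnicyclic (inversionGraph (splitSwitch π f)) ↔ IsUnicyclic (inversionGraph π) := by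
  have hcard := h.card_edges_splitSwitch
  constructor
  · rintro ⟨h1, h2⟩
    refine ⟨h.connected_splitSwitch_iff.1 h1, ?_⟩
    rw [Fintype.card_fin] at h2 ⊢
    omega
  · rintro ⟨h1, h2⟩
    refine ⟨h.connected_splitSwitch_iff.2 h1, ?_⟩
    rw [Fintype.card_fin] at h2 ⊢
    omega

end IsPivot

end Pivot

/-! ### Uniqueness of 4231 and the inverse map -/

section Bijection

open Finset SimpleGraph

variable {n : ℕ}

/-- Doubling a fixed point gives the same result on either side, so either copy may be regarded as
the inserted one. -/
theorem insertFixedPoint_castSucc_eq {π : Equiv.Perm (Fin n)} {m : Fin n} (h : π m = m) :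
    insertFixedPoint m.castSucc π = insertFixedPoint m.succ π := by
  have hne : ∀ x, x ≠ m → m.castSucc.succAbove x = m.succ.succAbove x := by
    intro x hx
    rcases lt_or_gt_of_ne hx with hlt | hlt
    · rw [Fin.succAbove_castSucc_of_lt _ _ hlt, Fin.succAbove_succ_of_le _ _ hlt.le]
    · rw [Fin.succAbove_castSucc_of_le _ _ hlt.le, Fin.succAbove_succ_of_lt _ _ hlt]
  ext y
  rcases Fin.eq_self_or_eq_succAbove m.succ y with rfl | ⟨x, rfl⟩
  · rw [insertFixedPoint_self]
    have := insertFixedPoint_succAbove m.castSucc π m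
    rw [h, Fin.succAbove_castSucc_self] at this
    rw [this]
  · rw [insertFixedPoint_succAbove]
    by_cases hx : x = m
    · subst hx
      rw [h, Fin.succAbove_succ_self, insertFixedPoint_self]
    · rw [← hne x hx, insertFixedPoint_succAbove, hne]
      exact fun h' => hx (π.injective (h'.trans h.symm))

/-- An occurrence of 321 that avoids the inserted fixed point comes from the given unique one. -/
theorem IsUniqueOccurrence.eq_succAbove {π : Equiv.Perm (Fin n)} {f : Fin 3 ↪o Fin n}
    (h : IsUniqueOccurrence pattern321 π f) {p a b c : Fin (n + 1)} (hab : a < b) (hbc : b < c)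
    (h1 : insertFixedPoint p π c < insertFixedPoint p π b)
    (h2 : insertFixedPoint p π b < insertFixedPoint p π a) (ha : a ≠ p) (hb : b ≠ p)
    (hc : c ≠ p) : a = p.succAbove (f 0) ∧ b = p.succAbove (f 1) ∧ c = p.succAbove (f 2) := by
  obtain ⟨a, rfl⟩ := (Fin.eq_self_or_eq_succAbove p a).resolve_left ha
  obtain ⟨b, rfl⟩ := (Fin.eq_self_or_eq_succAbove p b).resolve_left hb
  obtain ⟨c, rfl⟩ := (Fin.eq_self_or_eq_succAbove p c).resolve_left hc
  simp only [insertFixedPoint_succAbove, Fin.succAbove_lt_succAbove_iff] at hab hbc h1 h2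
  rw [← h.2 (orderEmbedding3 hab hbc) (isOccurrence_pattern321_iff.2 ⟨h1, h2⟩)]
  exact ⟨rfl, rfl, rfl⟩

/-- A 4231 consists of two occurrences of 321 with common outer letters. Each misses one of the two
copies of the fixed point, since these form no inversion, and so comes from the unique 321 in `π`.
-/
theorem IsUniqueOccurrence.pattern4231 {π : Equiv.Perm (Fin n)} {f : Fin 3 ↪o Fin n}
    (h : IsUniqueOccurrence pattern321 π f) :
    IsUniqueOccurrence pattern4231 (insertFixedPoint (f 1).succ π) (splitMiddle f) := by
  refine ⟨h.isPivot.pattern4231, fun g hg => ?_⟩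
  obtain ⟨h1, h2, h3⟩ := isOccurrence_pattern4231_iff.1 hg
  have h01 : f 0 < f 1 := f.strictMono (by decide)
  have h12 : f 1 < f 2 := f.strictMono (by decide)
  have key : ∀ {a b c : Fin (n + 1)}, a < b → b < c →
      insertFixedPoint (f 1).succ π c < insertFixedPoint (f 1).succ π b →
      insertFixedPoint (f 1).succ π b < insertFixedPoint (f 1).succ π a →
      a = (f 0).castSucc ∧ (b = (f 1).castSucc ∨ b = (f 1).succ) ∧ c = (f 2).succ := by
    intro a b c hab hbc hcb hba
    have hlt : (f 1).castSucc < (f 1).succ := Fin.castSucc_lt_succ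
    by_cases hp : a ≠ (f 1).succ ∧ b ≠ (f 1).succ ∧ c ≠ (f 1).succ
    · obtain ⟨e1, e2, e3⟩ := h.eq_succAbove hab hbc hcb hba hp.1 hp.2.1 hp.2.2
      rw [Fin.succAbove_succ_of_le _ _ h01.le] at e1
      rw [Fin.succAbove_succ_self] at e2
      rw [Fin.succAbove_succ_of_lt _ _ h12] at e3
      exact ⟨e1, Or.inl e2, e3⟩
    · have hq : a ≠ (f 1).castSucc ∧ b ≠ (f 1).castSucc ∧ c ≠ (f 1).castSucc := by
        have v1 := h.isPivot.insert_one
        have v2 := IsPivot.insert_two (π := π) (f := f)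
        grind
      rw [← insertFixedPoint_castSucc_eq h.apply_middle] at hcb hba
      obtain ⟨e1, e2, e3⟩ := h.eq_succAbove hab hbc hcb hba hq.1 hq.2.1 hq.2.2
      rw [Fin.succAbove_castSucc_of_lt _ _ h01] at e1
      rw [Fin.succAbove_castSucc_self] at e2
      rw [Fin.succAbove_castSucc_of_le _ _ h12.le] at e3
      exact ⟨e1, Or.inr e2, e3⟩
  have g01 : g 0 < g 1 := g.strictMono (by decide)
  have g02 : g 0 < g 2 := g.strictMono (by decide)
  have g12 : g 1 < g 2 := g.strictMono (by decide)
  have g13 : g 1 < g 3 := g.strictMono (by decide)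
  have g23 : g 2 < g 3 := g.strictMono (by decide)
  obtain ⟨e0, e1, e3⟩ := key g01 g13 h1 (h2.trans h3)
  obtain ⟨-, e2, -⟩ := key g02 g23 (h1.trans h2) h3
  have hlt : (f 1).castSucc < (f 1).succ := Fin.castSucc_lt_succ
  have e1' : g 1 = (f 1).castSucc := by grind
  have e2' : g 2 = (f 1).succ := by grind
  ext i
  fin_cases i
  · exact congrArg Fin.val e0
  · exact congrArg Fin.val e1'
  · exact congrArg Fin.val e2'
  · exact congrArg Fin.val e3

theorem insertAndSwitch_eq {π : Equiv.Perm (Fin n)} {f : Fin 3 ↪o Fin n}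
    (h : IsUniqueOccurrence pattern321 π f) : insertAndSwitch π = splitSwitch π f := by
  have hex : ∃ f : Fin 3 ↪o Fin n, IsUniqueOccurrence pattern321 π f := ⟨f, h⟩
  rw [insertAndSwitch, dif_pos hex, h.2 _ hex.choose_spec.1, splitSwitch]

theorem splitMiddle_injective : Function.Injective (splitMiddle (n := n)) := by
  intro f f' h
  have hi : ∀ i, splitMiddle f i = splitMiddle f' i := fun i => by rw [h]
  ext i
  fin_cases i
  · exact congrArg Fin.val (Fin.castSucc_injective _ (hi 0))
  · exact congrArg Fin.val (Fin.castSucc_injective _ (hi 1))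
  · exact congrArg Fin.val (Fin.succ_injective _ (hi 3))

theorem insertFixedPoint_injective (p : Fin (n + 1)) :
    Function.Injective (insertFixedPoint p) := by
  intro π π' h
  ext x
  have := congrArg (fun σ : Equiv.Perm (Fin (n + 1)) => σ (p.succAbove x)) h
  simp only [insertFixedPoint_succAbove] at this
  rw [Fin.succAbove_right_injective this]

theorem exists_insertFixedPoint_eq {p : Fin (n + 1)} {τ : Equiv.Perm (Fin (n + 1))}
    (h : τ p = p) : ∃ π, insertFixedPoint p π = τ := by
  let e := ((finSuccEquiv' p).symm.trans τ).trans (finSuccEquiv' p)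
  have hnone : e none = none := by simp [e, h]
  refine ⟨Equiv.removeNone e, ?_⟩
  have he : Equiv.optionCongr (Equiv.removeNone e) = e := by
    ext1 o
    cases o with
    | none => simp [hnone]
    | some x =>
      rw [Equiv.optionCongr_apply, Option.map_some]
      refine Equiv.removeNone_some e ?_
      rw [← Option.ne_none_iff_exists']
      intro h'
      exact Option.some_ne_none x (e.injective (h'.trans hnone.symm))
  rw [insertFixedPoint, he]
  ext y
  simp [e]

theorem changePattern_changePattern {k : ℕ} (τ τ' : Equiv.Perm (Fin k)) (g : Fin k ↪o Fin n)
    (σ : Equiv.Perm (Fin n)) : changePattern τ τ' g (changePattern τ' τ g σ) = σ := by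
  ext x
  by_cases hx : x ∈ Set.range g
  · obtain ⟨a, rfl⟩ := hx
    rw [changePattern_apply, changePattern_apply]
    simp
  · rw [changePattern_apply_of_notMem _ _ _ _ _ hx, changePattern_apply_of_notMem _ _ _ _ _ hx]

theorem succ_lt_succAbove_iff {m x : Fin n} : m.succ < m.succ.succAbove x ↔ m < x := by
  rcases le_or_gt x m with h | h
  · rw [Fin.succAbove_succ_of_le _ _ h]
    simp only [Fin.lt_def, Fin.le_def, Fin.val_succ, Fin.val_castSucc] at *
    omega
  · rw [Fin.succAbove_succ_of_lt _ _ h, Fin.succ_lt_succ_iff]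

theorem succAbove_lt_castSucc_iff {m x : Fin n} :
    m.succ.succAbove x < m.castSucc ↔ x < m := by
  conv_lhs => rw [← Fin.succAbove_succ_self m]
  exact Fin.succAbove_lt_succAbove_iff

/-- The positions and letters of the unique 3412 in a permutation with a unicyclic inversion
graph. -/
theorem IsUnicyclic.eq_of_pattern3412 {σ : Equiv.Perm (Fin n)} {g : Fin 4 ↪o Fin n}
    (hU : IsUnicyclic (inversionGraph σ)) (h : IsOccurrence pattern3412 σ g) :
    (g 2 : ℕ) = g 1 + 1 ∧ σ (g 0) = g 2 ∧ σ (g 3) = g 1 := by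
  obtain ⟨h1, h2, h3⟩ := isOccurrence_pattern3412_iff.1 h
  have g01 : g 0 < g 1 := g.strictMono (by decide)
  have g12 : g 1 < g 2 := g.strictMono (by decide)
  have g23 : g 2 < g 3 := g.strictMono (by decide)
  have hout := fun {x} => @IsUnicyclic.outside_pattern3412 n σ g hU h x
  have e1 : (g 2 : ℕ) = g 1 + 1 := by
    -- A position strictly between the two middle ones would belong to an outside letter in neither
    -- of the two allowed regions; the same argument applies to the values below.
    by_contra hne
    have hlt : (g 1 : ℕ) + 1 < g 2 := by rw [Fin.lt_def] at g12; omega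
    let x : Fin n := ⟨g 1 + 1, hlt.trans (g 2).2⟩
    have hx1 : g 1 < x := Fin.lt_def.2 (Nat.lt_succ_self _)
    have hx2 : x < g 2 := hlt
    have hx : x ∉ Set.range g := by
      rintro ⟨i, hi⟩
      rw [← hi, g.lt_iff_lt] at hx1 hx2
      rw [Fin.lt_def] at hx1 hx2
      simp at hx1 hx2
      omega
    rcases hout hx with h' | h'
    · exact hx1.asymm h'.1
    · exact hx2.asymm h'.1
  have e3 : (σ (g 0) : ℕ) = σ (g 3) + 1 := by
    by_contra hne
    have hlt : (σ (g 3) : ℕ) + 1 < σ (g 0) := by rw [Fin.lt_def] at h2; omega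
    obtain ⟨x, hx⟩ := σ.surjective ⟨σ (g 3) + 1, hlt.trans (σ (g 0)).2⟩
    have hx1 : σ (g 3) < σ x := by rw [hx]; exact Fin.lt_def.2 (Nat.lt_succ_self _)
    have hx2 : σ x < σ (g 0) := by rw [hx]; exact hlt
    have hxr : x ∉ Set.range g := by
      rintro ⟨i, rfl⟩
      fin_cases i
      · exact lt_irrefl _ hx2
      · exact hx2.asymm h3
      · exact hx1.asymm h1
      · exact lt_irrefl _ hx1
    rcases hout hxr with h' | h'
    · exact hx1.asymm h'.2
    · exact hx2.asymm h'.2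
  have e4 : g 1 = σ (g 3) := by
    -- Once the letters at `g 0` and `g 2` are exchanged, exactly the positions before `g 1` carry
    -- letters below `σ (g 3)`.
    refine eq_of_forall_lt_iff ((Equiv.swap (g 0) (g 2)).trans σ) fun x => ?_
    rw [Equiv.trans_apply]
    by_cases hx : x ∈ Set.range g
    · obtain ⟨i, rfl⟩ := hx
      fin_cases i
      · simp [h1, g01]
      · simp [Equiv.swap_apply_of_ne_of_ne g01.ne' g12.ne, (h2.trans h3).le]
      · simp [h2.le]
      · simp [Equiv.swap_apply_of_ne_of_ne (g01.trans (g12.trans g23)).ne' g23.ne']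
    · rw [Equiv.swap_apply_of_ne_of_ne (fun h => hx ⟨0, h.symm⟩) (fun h => hx ⟨2, h.symm⟩)]
      rcases hout hx with h' | h'
      · exact iff_of_true h'.1 h'.2
      · exact iff_of_false (g12.trans h'.1).asymm (h2.trans h'.2).asymm
  refine ⟨e1, Fin.ext ?_, e4.symm⟩
  rw [e3, e1, ← e4]

/-- Changing the 3412 back to 4231 makes `g 1` and `g 2` adjacent fixed points by
`IsUnicyclic.eq_of_pattern3412`; removing the second leaves a 321. The pivot condition is the
description of the outside letters. -/
theorem exists_splitSwitch_eq {σ : Equiv.Perm (Fin (n + 1))} {g : Fin 4 ↪o Fin (n + 1)}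
    (hU : IsUnicyclic (inversionGraph σ)) (h : IsOccurrence pattern3412 σ g) :
    ∃ π f, IsPivot π f ∧ splitSwitch π f = σ := by
  obtain ⟨h1, h2, h3⟩ := isOccurrence_pattern3412_iff.1 h
  obtain ⟨e1, e2, e3⟩ := hU.eq_of_pattern3412 h
  have g01 : g 0 < g 1 := g.strictMono (by decide)
  have g12 : g 1 < g 2 := g.strictMono (by decide)
  have g23 : g 2 < g 3 := g.strictMono (by decide)
  obtain ⟨m, hm⟩ := Fin.exists_castSucc_eq.2 (ne_of_lt (g12.trans_le (Fin.le_last _)))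
  obtain ⟨a, ha⟩ := Fin.exists_castSucc_eq.2
    (ne_of_lt ((g01.trans g12).trans_le (Fin.le_last _)))
  obtain ⟨c, hc⟩ := Fin.exists_succ_eq.2 (ne_of_gt ((Fin.zero_le _).trans_lt g23))
  have hm2 : m.succ = g 2 := by
    ext
    rw [e1, ← hm]
    rfl
  have ham : a < m := by rwa [← ha, ← hm, Fin.castSucc_lt_castSucc_iff] at g01
  have hmc : m < c := by rwa [← hm2, ← hc, Fin.succ_lt_succ_iff] at g23
  let f := orderEmbedding3 ham hmc
  have hf0 : f 0 = a := rfl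
  have hf1 : f 1 = m := rfl
  have hf2 : f 2 = c := rfl
  have hfg : splitMiddle f = g := by
    ext i
    fin_cases i
    · exact congrArg Fin.val ha
    · exact congrArg Fin.val hm
    · exact congrArg Fin.val hm2
    · exact congrArg Fin.val hc
  have t0 : changePattern pattern3412 pattern4231 g σ (g 0) = σ (g 1) :=
    changePattern_apply _ _ g σ 0
  have t1 : changePattern pattern3412 pattern4231 g σ (g 1) = σ (g 3) :=
    changePattern_apply _ _ g σ 1
  have t2 : changePattern pattern3412 pattern4231 g σ (g 2) = σ (g 0) :=
    changePattern_apply _ _ g σ 2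
  have t3 : changePattern pattern3412 pattern4231 g σ (g 3) = σ (g 2) :=
    changePattern_apply _ _ g σ 3
  obtain ⟨π, hπ⟩ := exists_insertFixedPoint_eq (p := m.succ)
    (τ := changePattern pattern3412 pattern4231 g σ) (by rw [hm2, t2, e2])
  have hval : ∀ x, changePattern pattern3412 pattern4231 g σ (m.succ.succAbove x) =
      m.succ.succAbove (π x) := fun x => by rw [← hπ, insertFixedPoint_succAbove]
  have v0 := hval a
  have v1 := hval m
  have v2 := hval c
  rw [Fin.succAbove_succ_of_le _ _ ham.le, ha, t0] at v0
  rw [Fin.succAbove_succ_self, hm, t1, e3, ← hm] at v1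
  rw [Fin.succAbove_succ_of_lt _ _ hmc, hc, t3] at v2
  have p0 : m < π a := by
    rw [← succ_lt_succAbove_iff, ← v0, hm2, ← e2]
    exact h3
  have p1 : π m = m := by
    conv_lhs at v1 => rw [← Fin.succAbove_succ_self m]
    exact (Fin.succAbove_right_injective v1).symm
  have p2 : π c < m := by
    rw [← succAbove_lt_castSucc_iff, ← v2, hm, ← e3]
    exact h1
  refine ⟨π, f, ⟨isOccurrence_pattern321_iff.2 ⟨?_, ?_⟩, p1, fun x hx => ?_⟩, ?_⟩
  · rwa [hf1, hf2, p1]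
  · rwa [hf1, hf0, p1]
  · rw [hf1]
    have hxm : x ≠ m := fun h' => hx ⟨1, h'.symm⟩
    have hy : m.succ.succAbove x ∉ Set.range g := by
      rw [← hfg]
      rcases lt_or_gt_of_ne hxm with hlt | hlt
      · rw [Fin.succAbove_succ_of_le _ _ hlt.le]
        exact castSucc_notMem_range_splitMiddle hx hlt
      · rw [Fin.succAbove_succ_of_lt _ _ hlt]
        exact succ_notMem_range_splitMiddle hx hlt
    have hv := hval x
    rw [changePattern_apply_of_notMem _ _ _ _ _ hy] at hv
    have hout := hU.outside_pattern3412 h hy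
    rw [hv, e3, e2, ← hm, ← hm2, succAbove_lt_castSucc_iff, succAbove_lt_castSucc_iff,
      succ_lt_succAbove_iff, succ_lt_succAbove_iff] at hout
    rcases hout with h' | h'
    · exact iff_of_true h'.1 h'.2
    · exact iff_of_false h'.1.asymm h'.2.asymm
  · rw [splitSwitch, hf1, hπ, hfg, changePattern_changePattern]

theorem bijOn_insertAndSwitch (hn : 0 < n) :
    Set.BijOn (insertAndSwitch (n := n)) (B n 2) (B (n + 1) 3) := by
  refine ⟨?_, ?_, ?_⟩
  · intro π hπ
    obtain ⟨hU, f, hf⟩ := (mem_B_two_iff hn).1 hπ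
    have hf' := hU.pattern321_unique hf
    rw [insertAndSwitch_eq hf', mem_B_three_iff n.succ_pos]
    exact ⟨hf'.isPivot.isUnicyclic_splitSwitch_iff.2 hU, _, hf'.isPivot.pattern3412⟩
  · intro π₁ h₁ π₂ h₂ heq
    obtain ⟨hU₁, f₁, hf₁⟩ := (mem_B_two_iff hn).1 h₁
    obtain ⟨hU₂, f₂, hf₂⟩ := (mem_B_two_iff hn).1 h₂
    have hf₁' := hU₁.pattern321_unique hf₁
    have hf₂' := hU₂.pattern321_unique hf₂
    rw [insertAndSwitch_eq hf₁', insertAndSwitch_eq hf₂'] at heq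
    have hocc := hf₁'.isPivot.pattern3412
    have hU := hf₂'.isPivot.isUnicyclic_splitSwitch_iff.2 hU₂
    rw [heq] at hocc
    -- The common image has only one 3412, which determines the 321; both steps of the construction
    -- can then be undone.
    obtain rfl : f₁ = f₂ := splitMiddle_injective
      ((hU.pattern3412_unique hf₂'.isPivot.pattern3412).2 _ hocc)
    have := congrArg (changePattern pattern3412 pattern4231 (splitMiddle f₁)) heq
    rw [splitSwitch, splitSwitch, changePattern_changePattern, changePattern_changePattern] at this
    exact insertFixedPoint_injective _ this
  · intro σ hσ
    obtain ⟨hU, g, hg⟩ := (mem_B_three_iff n.succ_pos).1 hσ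
    obtain ⟨π, f, hpiv, rfl⟩ := exists_splitSwitch_eq hU hg
    have hUπ := hpiv.isUnicyclic_splitSwitch_iff.1 hU
    exact ⟨π, (mem_B_two_iff hn).2 ⟨hUπ, f, hpiv.occurrence⟩,
      insertAndSwitch_eq (hUπ.pattern321_unique hpiv.occurrence)⟩

end Bijection

end NonAmbiguousTrees

theorem mainTheorem7 (n : ℕ) (hn : 3 ≤ n) :
    (∀ π ∈ NonAmbiguousTrees.B n 2, ∃ f : Fin 3 ↪o Fin n,
      -- `i = f 0`, `j = f 1`, `k = f 2` are the positions of the unique 321, and `π j = j`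
      NonAmbiguousTrees.IsUniqueOccurrence NonAmbiguousTrees.pattern321 π f ∧
      π (f 1) = f 1 ∧
      -- after the insertion, `i, j, j + 1, k + 1` are the positions of the unique 4231
      NonAmbiguousTrees.IsUniqueOccurrence NonAmbiguousTrees.pattern4231
        (NonAmbiguousTrees.insertFixedPoint (f 1).succ π) (NonAmbiguousTrees.splitMiddle f) ∧
      -- the values of the image of `π`
      NonAmbiguousTrees.insertAndSwitch π (f 0).castSucc = (f 1).succ ∧
      NonAmbiguousTrees.insertAndSwitch π (f 1).castSucc = (π (f 0)).succ ∧
      NonAmbiguousTrees.insertAndSwitch π (f 1).succ = (π (f 2)).castSucc ∧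
      NonAmbiguousTrees.insertAndSwitch π (f 2).succ = (f 1).castSucc ∧
      (∀ l : Fin (n + 1), l ≠ (f 0).castSucc → l ≠ (f 1).castSucc → l ≠ (f 1).succ →
        l ≠ (f 2).succ → NonAmbiguousTrees.insertAndSwitch π l =
          NonAmbiguousTrees.insertFixedPoint (f 1).succ π l) ∧
      -- the 4231 has become a 3412
      NonAmbiguousTrees.IsOccurrence NonAmbiguousTrees.pattern3412
        (NonAmbiguousTrees.insertAndSwitch π) (NonAmbiguousTrees.splitMiddle f)) ∧
    Set.BijOn (NonAmbiguousTrees.insertAndSwitch (n := n))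
      (NonAmbiguousTrees.B n 2) (NonAmbiguousTrees.B (n + 1) 3) := by
  have hn0 : 0 < n := by omega
  refine ⟨fun π hπ => ?_, NonAmbiguousTrees.bijOn_insertAndSwitch hn0⟩
  obtain ⟨hU, f, hf⟩ := (NonAmbiguousTrees.mem_B_two_iff hn0).1 hπ
  have hf' := hU.pattern321_unique hf
  have hp := hf'.isPivot
  rw [NonAmbiguousTrees.insertAndSwitch_eq hf']
  refine ⟨f, hf', hp.fixed, hf'.pattern4231, NonAmbiguousTrees.IsPivot.splitSwitch_zero,
    hp.splitSwitch_one, hp.splitSwitch_two, hp.splitSwitch_three, fun l h0 h1 h2 h3 => ?_, hp.pattern3412⟩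
  refine NonAmbiguousTrees.IsPivot.splitSwitch_of_notMem ?_
  rintro ⟨i, rfl⟩
  fin_cases i
  · exact h0 rfl
  · exact h1 rfl
  · exact h2 rfl
  · exact h3 rfl
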